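/- An instance of weighted fair $k$-set selection consists of a finite bipartite graph $G=(L\cup R,E)$, a non-negative rational weight $w_v$ for every $v\in R$, and a demand $k\in\mathbb{N}$ with $1\le k\le |R|$. A feasible solution is a set $S\subseteq R$ with $|S|\ge k$. Its maximum disagreement is $\max_{u\in L}\sum_{v\in N_G(u)\cap S}w_v$ (read as $0$ if $L=\emptyset$), and the goal is to minimize it over all feasible solutions. Instances are encoded in the usual way, by the adjacency matrix of $G$ and all numbers in binary, each weight as a numerator and a denominator. **Theorem.** On bipartite graphs of maximum degree at most $2$ (over all vertices of $L\cup R$), weighted fair $k$-set selection is in $\mathsf{P}$. That is: 1. the decision problem that asks, given such an instance and a non-negative rational bound $b$, whether some feasible solution has maximum disagreement at most $b$, belongs to $\mathsf{P}$; and 2. there is a deterministic algorithm that, given such an instance, outputs a feasible solution of minimum maximum disagreement, in time polynomial in the bit length of the input. Time is measured on random access machines (with addition, truncated subtraction and multiplication of natural numbers) with logarithmic cost, which are polynomially equivalent to Turing machines. -/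

import Mathlib

/-! ### Random access machines with logarithmic cost, and polynomial time -/

namespace LogRAM

/-- A memory state: registers `reg 0, reg 1, …` and random access arrays `arr 0, arr 1, …`, each an
infinite sequence of cells.  All of them hold natural numbers.  A program mentions only finitely
many registers and arrays. -/
@[ext]
structure State where
  reg : ℕ → ℕ
  arr : ℕ → ℕ → ℕ

/-- Arithmetic expressions. -/
inductive Expr where
  /-- a constant -/
  | const (c : ℕ)
  /-- the content of register `r` -/
  | reg (r : ℕ)
  /-- the content of the cell of array `a` whose index is the value of the expression -/
  | get (a : ℕ) (index : Expr)
  | add (e₁ e₂ : Expr)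
  /-- truncated subtraction -/
  | sub (e₁ e₂ : Expr)
  | mul (e₁ e₂ : Expr)

/-- The value of an expression. -/
def Expr.eval (s : State) : Expr → ℕ
  | .const c => c
  | .reg r => s.reg r
  | .get a e => s.arr a (e.eval s)
  | .add e₁ e₂ => e₁.eval s + e₂.eval s
  | .sub e₁ e₂ => e₁.eval s - e₂.eval s
  | .mul e₁ e₂ => e₁.eval s * e₂.eval s

/-- The logarithmic cost of a number: one plus its number of binary digits. -/
def logCost (a : ℕ) : ℕ := Nat.size a + 1

/-- The logarithmic cost of evaluating an expression: every value that occurs in the evaluation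
(constants, register contents, addresses, cell contents, intermediate results) is charged. -/
def Expr.cost (s : State) : Expr → ℕ
  | .const c => logCost c
  | .reg r => logCost (s.reg r)
  | .get a e => e.cost s + logCost (s.arr a (e.eval s))
  | .add e₁ e₂ => e₁.cost s + e₂.cost s + logCost (e₁.eval s + e₂.eval s)
  | .sub e₁ e₂ => e₁.cost s + e₂.cost s + logCost (e₁.eval s - e₂.eval s)
  | .mul e₁ e₂ => e₁.cost s + e₂.cost s + logCost (e₁.eval s * e₂.eval s)

/-- Programs. -/
inductive Prog where
  | skip
  /-- `reg r := e` -/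
  | assign (r : ℕ) (e : Expr)
  /-- `arr a [index] := e` -/
  | store (a : ℕ) (index e : Expr)
  | seq (p q : Prog)
  /-- run `p` if `e` is non-zero, and `q` otherwise -/
  | ite (e : Expr) (p q : Prog)
  /-- run `p` as long as `e` is non-zero -/
  | loop (e : Expr) (p : Prog)

/-- `Exec p s t s'`: started in state `s`, the program `p` halts in state `s'`, and the total
logarithmic cost of the run is `t`. -/
inductive Exec : Prog → State → ℕ → State → Prop where
  | skip (s : State) : Exec .skip s 1 s
  | assign (s : State) (r : ℕ) (e : Expr) :
      Exec (.assign r e) s (e.cost s + 1) { s with reg := Function.update s.reg r (e.eval s) }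
  | store (s : State) (a : ℕ) (index e : Expr) :
      Exec (.store a index e) s (index.cost s + e.cost s + 1)
        { s with
          arr := Function.update s.arr a
            (Function.update (s.arr a) (index.eval s) (e.eval s)) }
  | seq {p q : Prog} {s s' s'' : State} {t t' : ℕ} :
      Exec p s t s' → Exec q s' t' s'' → Exec (.seq p q) s (t + t') s''
  | ite_true {e : Expr} {p q : Prog} {s s' : State} {t : ℕ} :
      e.eval s ≠ 0 → Exec p s t s' → Exec (.ite e p q) s (e.cost s + 1 + t) s'
  | ite_false {e : Expr} {p q : Prog} {s s' : State} {t : ℕ} :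
      e.eval s = 0 → Exec q s t s' → Exec (.ite e p q) s (e.cost s + 1 + t) s'
  | loop_stop {e : Expr} {p : Prog} {s : State} :
      e.eval s = 0 → Exec (.loop e p) s (e.cost s + 1) s
  | loop_step {e : Expr} {p : Prog} {s s' s'' : State} {t t' : ℕ} :
      e.eval s ≠ 0 → Exec p s t s' → Exec (.loop e p) s' t' s'' →
      Exec (.loop e p) s (e.cost s + 1 + t + t') s''

/-- The initial state on the input word `x`: the word stands in array `0`, its length in
register `0`, and everything else is `0`. -/
def State.init (x : List ℕ) : State where
  reg r := if r = 0 then x.length else 0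
  arr a i := if a = 0 then x.getD i 0 else 0

/-- The output word of a final state: it stands in array `1`, its length in register `0`. -/
def State.output (s : State) : List ℕ := (List.range (s.reg 0)).map (s.arr 1)

/-- The length of an input word whose letters are written in binary and separated. -/
def inputSize (x : List ℕ) : ℕ := (x.map logCost).sum

/-- The class `P`: some program halts on every input word within a time that is polynomial in the
bit length of the word, and it accepts (by leaving a non-zero number in register `0`) exactly the
members of `A`. -/
def InP (A : Set (List ℕ)) : Prop :=
  ∃ (c : Prog) (p : Polynomial ℕ), ∀ x : List ℕ, ∃ (t : ℕ) (s : State),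
    Exec c (State.init x) t s ∧ t ≤ p.eval (inputSize x) ∧ (s.reg 0 ≠ 0 ↔ x ∈ A)

/-- The search problem `R` is solvable in polynomial time: some program halts on every input word
`x` within a time that is polynomial in the bit length of `x`, and it outputs a solution of `x` if
there is one. -/
def PolyTimeSolvable (R : List ℕ → List ℕ → Prop) : Prop :=
  ∃ (c : Prog) (p : Polynomial ℕ), ∀ x : List ℕ, ∃ (t : ℕ) (s : State),
    Exec c (State.init x) t s ∧ t ≤ p.eval (inputSize x) ∧ ((∃ y, R x y) → R x s.output)

end LogRAM

/-! ### Weighted fair k-set selection -/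

/-- An instance of weighted fair `k`-set selection: a bipartite graph with sides `L = Fin n` and
`R = Fin m`, non-negative rational weights on `R`, and a demand `1 ≤ k ≤ m`. -/
structure FairSetSelection where
  n : ℕ
  m : ℕ
  k : ℕ
  adj : Fin n → Fin m → Bool
  w : Fin m → ℚ≥0
  one_le_k : 1 ≤ k
  k_le_m : k ≤ m

namespace FairSetSelection

variable (I : FairSetSelection)

/-- The neighbours in `R` of a vertex of `L`. -/
def nbrL (u : Fin I.n) : Finset (Fin I.m) := Finset.univ.filter fun v => I.adj u v = true

/-- The neighbours in `L` of a vertex of `R`. -/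
def nbrR (v : Fin I.m) : Finset (Fin I.n) := Finset.univ.filter fun u => I.adj u v = true

/-- The maximum degree `Δ` over all vertices of `L ∪ R`. -/
def maxDegree : ℕ :=
  max (Finset.univ.sup fun u => (I.nbrL u).card) (Finset.univ.sup fun v => (I.nbrR v).card)

/-- A feasible solution selects at least `k` vertices of `R`. -/
def IsFeasible (S : Finset (Fin I.m)) : Prop := I.k ≤ S.card

/-- The disagreement of `u ∈ L`: the total weight of its selected neighbours. -/
def dis (S : Finset (Fin I.m)) (u : Fin I.n) : ℚ≥0 := ∑ v ∈ I.nbrL u ∩ S, I.w v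

/-- The maximum disagreement over `L` (it is `0` if `L` is empty). -/
def maxDis (S : Finset (Fin I.m)) : ℚ≥0 := Finset.univ.sup (I.dis S)

/-- A feasible solution of minimum maximum disagreement. -/
def IsOptimal (S : Finset (Fin I.m)) : Prop :=
  I.IsFeasible S ∧ ∀ S' : Finset (Fin I.m), I.IsFeasible S' → I.maxDis S ≤ I.maxDis S'

/-- The word `x` encodes the instance: it lists `n`, `m`, `k`, then the adjacency matrix row by row
as zeros and ones, then the weights in order, each as a numerator and a non-zero denominator
(not necessarily in lowest terms). -/
def IsEncoding (x : List ℕ) : Prop :=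
  ∃ num den : Fin I.m → ℕ, (∀ v, den v ≠ 0 ∧ I.w v = (num v : ℚ≥0) / (den v : ℚ≥0)) ∧
    x = [I.n, I.m, I.k]
      ++ (List.ofFn fun u => List.ofFn fun v => if I.adj u v then 1 else 0).flatten
      ++ (List.ofFn fun v => [num v, den v]).flatten

/-- The word that encodes a selection: its indicator vector. -/
def selectionWord (S : Finset (Fin I.m)) : List ℕ :=
  List.ofFn fun v => if v ∈ S then 1 else 0

/-- The decision problem on bipartite graphs of maximum degree at most `d`: an input word encodes
an instance of maximum degree at most `d`, followed by a bound `b` as a numerator and a non-zero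
denominator, and the question is whether some feasible solution has maximum disagreement at
most `b`. -/
def decisionProblem (d : ℕ) : Set (List ℕ) :=
  {x | ∃ (I : FairSetSelection) (y : List ℕ) (bnum bden : ℕ),
    I.maxDegree ≤ d ∧ I.IsEncoding y ∧ bden ≠ 0 ∧ x = y ++ [bnum, bden] ∧
    ∃ S, I.IsFeasible S ∧ I.maxDis S ≤ (bnum : ℚ≥0) / (bden : ℚ≥0)}

/-- The optimization problem on bipartite graphs of maximum degree at most `d`: `y` is an optimal
solution of the instance, of maximum degree at most `d`, that `x` encodes. -/
def optimizationProblem (d : ℕ) (x y : List ℕ) : Prop :=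
  ∃ I : FairSetSelection, I.maxDegree ≤ d ∧ I.IsEncoding x ∧
    ∃ S, I.IsOptimal S ∧ y = I.selectionWord S

end FairSetSelection

/-!
For a fixed threshold `b`, a selection has maximum disagreement at most `b` if and only if it
contains no conflict: since every vertex of `L` has at most two neighbours, it is enough that the
weight of `{v, w}` is at most `b` whenever the selected vertices `v` and `w`, possibly equal, have a
common neighbour (`FairWord.Represents.maxDis_le_iff`).  As every vertex of `R` has at most two
neighbours as well, the conflict graph on `R` has maximum degree at most two
(`FairWord.card_nbrs_le`), and one has to find a maximum independent set in it.

This is done greedily: as long as there are vertices left, one selects a vertex with at most one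
remaining neighbour, or any vertex if there is none, and deletes it together with its neighbours.
In the second case all that is left is a union of cycles; that any vertex `v` of a cycle lies in
some maximum independent set is seen by shifting a given one along the path that remains when `v` is
removed (`GreedyIndep.exists_indep_avoiding_ends`, `GreedyIndep.exists_indep_prune`).

The minimum maximum disagreement is `0` or the weight of some set `{v, w}`, so that the optimization
problem is solved by trying these polynomially many thresholds (`FairWord.exists_isOptimal`).

The programs are verified in a program logic, `LogRAM.WP N`, for total correctness under the
condition that the memory never holds numbers of more than `N + 1` bits and that no loop makes more
than `N` passes.  The running time is then bounded by the value at `N` of a polynomial,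
`LogRAM.Prog.timePoly`, that depends only on the program, and no further time analysis is needed
than to check the two conditions for an `N` that is linear in the length of the input.
Weights are compared by cross-multiplication, so that no stored number has more than linearly
many bits.
-/

/-! ### A program logic for random access machines -/

namespace LogRAM

/-- Overwrite register `r` by `v`. -/
def State.setReg (s : State) (r v : ℕ) : State :=
  { s with reg := Function.update s.reg r v }

/-- Overwrite cell `i` of array `a` by `v`. -/
def State.setArr (s : State) (a i v : ℕ) : State :=
  { s with arr := Function.update s.arr a (Function.update (s.arr a) i v) }

@[simp] theorem State.reg_setReg (s : State) (r v r' : ℕ) :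
    (s.setReg r v).reg r' = if r' = r then v else s.reg r' := by
  simp [State.setReg, Function.update_apply]

@[simp] theorem State.arr_setReg (s : State) (r v : ℕ) : (s.setReg r v).arr = s.arr := rfl

@[simp] theorem State.reg_setArr (s : State) (a i v : ℕ) : (s.setArr a i v).reg = s.reg := rfl

@[simp] theorem State.arr_setArr (s : State) (a i v a' : ℕ) :
    (s.setArr a i v).arr a' = if a' = a then Function.update (s.arr a) i v else s.arr a' := by
  simp only [State.setArr, Function.update_apply]

/-- All numbers in memory have at most `N + 1` binary digits. -/
def State.Bounded (N : ℕ) (s : State) : Prop :=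
  (∀ r, s.reg r < 2 ^ (N + 1)) ∧ ∀ a i, s.arr a i < 2 ^ (N + 1)

theorem State.Bounded.setReg {N : ℕ} {s : State} (h : s.Bounded N) {r v : ℕ}
    (hv : v < 2 ^ (N + 1)) : (s.setReg r v).Bounded N := by
  refine ⟨fun r' => ?_, h.2⟩
  rw [State.reg_setReg]
  split_ifs
  exacts [hv, h.1 r']

theorem State.Bounded.setArr {N : ℕ} {s : State} (h : s.Bounded N) {a i v : ℕ}
    (hv : v < 2 ^ (N + 1)) : (s.setArr a i v).Bounded N := by
  refine ⟨h.1, fun a' i' => ?_⟩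
  rw [State.arr_setArr]
  split_ifs
  · rw [Function.update_apply]
    split_ifs
    exacts [hv, h.2 a i']
  · exact h.2 a' i'

/-- The value of `e` in a state with `(N + 1)`-bit memory has at most `e.width * (N + 1)` bits. -/
def Expr.width : Expr → ℕ
  | .const c => c.size + 1
  | .reg _ => 1
  | .get _ _ => 1
  | .add e₁ e₂ => e₁.width + e₂.width
  | .sub e₁ e₂ => e₁.width + e₂.width
  | .mul e₁ e₂ => e₁.width + e₂.width

theorem Expr.one_le_width (e : Expr) : 1 ≤ e.width := by
  induction e <;> simp only [Expr.width] <;> omega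

theorem Expr.eval_lt {N : ℕ} {s : State} (h : s.Bounded N) (e : Expr) :
    e.eval s < 2 ^ (e.width * (N + 1)) := by
  induction e with
  | const c =>
    refine (Nat.lt_size_self c).trans_le (Nat.pow_le_pow_right two_pos ?_)
    simp only [Expr.width]
    nlinarith
  | reg r => simpa [Expr.width, Expr.eval] using h.1 r
  | get a e _ => simpa [Expr.width, Expr.eval] using h.2 a (e.eval s)
  | add e₁ e₂ h₁ h₂ =>
    simp only [Expr.width, Expr.eval, add_mul, pow_add _ (e₁.width * (N + 1))]
    have two_le : ∀ e : Expr, 2 ≤ 2 ^ (e.width * (N + 1)) := fun e =>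
      calc 2 = 2 ^ 1 := rfl
        _ ≤ _ := Nat.pow_le_pow_right two_pos (Nat.mul_pos e.one_le_width N.succ_pos)
    have := two_le e₁
    have := two_le e₂
    nlinarith
  | sub e₁ e₂ h₁ h₂ =>
    refine (Nat.sub_le _ _).trans_lt (h₁.trans_le (Nat.pow_le_pow_right two_pos ?_))
    simp only [Expr.width]
    nlinarith
  | mul e₁ e₂ h₁ h₂ =>
    simp only [Expr.width, Expr.eval, add_mul, pow_add]
    exact Nat.mul_lt_mul'' h₁ h₂

/-- The cost of evaluating `e` in a state with `(N + 1)`-bit memory is at most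
`e.costFactor * (N + 1)`. -/
def Expr.costFactor : Expr → ℕ
  | .const c => c.size + 1
  | .reg _ => 2
  | .get _ e => e.costFactor + 2
  | .add e₁ e₂ => e₁.costFactor + e₂.costFactor + (e₁.width + e₂.width + 1)
  | .sub e₁ e₂ => e₁.costFactor + e₂.costFactor + (e₁.width + e₂.width + 1)
  | .mul e₁ e₂ => e₁.costFactor + e₂.costFactor + (e₁.width + e₂.width + 1)

theorem logCost_le {w N v : ℕ} (h : v < 2 ^ (w * (N + 1))) : logCost v ≤ (w + 1) * (N + 1) := by
  have := Nat.size_le.2 h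
  rw [logCost]
  nlinarith

theorem Expr.cost_le {N : ℕ} {s : State} (h : s.Bounded N) (e : Expr) :
    e.cost s ≤ e.costFactor * (N + 1) := by
  induction e with
  | const c =>
    simp only [Expr.cost, Expr.costFactor, logCost]
    nlinarith
  | reg r => exact logCost_le (w := 1) (by simpa using h.1 r)
  | get a e ih =>
    have := logCost_le (w := 1) (N := N) (v := s.arr a (e.eval s)) (by simpa using h.2 a _)
    simp only [Expr.cost, Expr.costFactor]
    nlinarith
  | add e₁ e₂ h₁ h₂ =>
    have := logCost_le (Expr.eval_lt h (.add e₁ e₂))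
    simp only [Expr.cost, Expr.costFactor, Expr.eval, Expr.width] at this ⊢
    nlinarith
  | sub e₁ e₂ h₁ h₂ =>
    have := logCost_le (Expr.eval_lt h (.sub e₁ e₂))
    simp only [Expr.cost, Expr.costFactor, Expr.eval, Expr.width] at this ⊢
    nlinarith
  | mul e₁ e₂ h₁ h₂ =>
    have := logCost_le (Expr.eval_lt h (.mul e₁ e₂))
    simp only [Expr.cost, Expr.costFactor, Expr.eval, Expr.width] at this ⊢
    nlinarith

/-- A bound, polynomial in `N`, for the running time of a program whose memory never holds numbers
of more than `N + 1` bits and whose loops make at most `N` passes each time they are entered. -/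
noncomputable def Prog.timePoly : Prog → Polynomial ℕ
  | .skip => 1
  | .assign _ e => .C e.costFactor * (.X + 1) + 1
  | .store _ i e => (.C i.costFactor + .C e.costFactor) * (.X + 1) + 1
  | .seq p q => p.timePoly + q.timePoly
  | .ite e p q => .C e.costFactor * (.X + 1) + 1 + (p.timePoly + q.timePoly)
  | .loop e p => (.X + 1) * (.C e.costFactor * (.X + 1) + 1 + p.timePoly)

/-- The registers that a program may change. -/
def Prog.modReg : Prog → List ℕ
  | .skip => []
  | .assign r _ => [r]
  | .store _ _ _ => []
  | .seq p q => p.modReg ++ q.modReg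
  | .ite _ p q => p.modReg ++ q.modReg
  | .loop _ p => p.modReg

/-- The arrays that a program may change. -/
def Prog.modArr : Prog → List ℕ
  | .skip => []
  | .assign _ _ => []
  | .store a _ _ => [a]
  | .seq p q => p.modArr ++ q.modArr
  | .ite _ p q => p.modArr ++ q.modArr
  | .loop _ p => p.modArr

/-- The states `s` and `s'` differ at most in the registers `R` and the arrays `A`. -/
structure Frame (R A : List ℕ) (s s' : State) : Prop where
  reg : ∀ r, r ∉ R → s'.reg r = s.reg r
  arr : ∀ a, a ∉ A → s'.arr a = s.arr a

theorem Frame.refl (R A : List ℕ) (s : State) : Frame R A s s := ⟨fun _ _ => rfl, fun _ _ => rfl⟩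

theorem Frame.trans {R A : List ℕ} {s s' s'' : State} (h : Frame R A s s') (h' : Frame R A s' s'') :
    Frame R A s s'' :=
  ⟨fun r hr => (h'.reg r hr).trans (h.reg r hr), fun a ha => (h'.arr a ha).trans (h.arr a ha)⟩

theorem Frame.mono {R A R' A' : List ℕ} {s s' : State} (h : Frame R A s s')
    (hR : ∀ r ∈ R, r ∈ R') (hA : ∀ a ∈ A, a ∈ A') : Frame R' A' s s' :=
  ⟨fun r hr => h.reg r fun h' => hr (hR r h'), fun a ha => h.arr a fun h' => ha (hA a h')⟩

theorem Frame.setReg {R A : List ℕ} (s : State) {r : ℕ} (hr : r ∈ R) (v : ℕ) :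
    Frame R A s (s.setReg r v) := by
  refine ⟨fun r' hr' => ?_, fun _ _ => rfl⟩
  rw [State.reg_setReg, if_neg (by rintro rfl; exact hr' hr)]

theorem Exec.frame {c : Prog} {s s' : State} {t : ℕ} (h : Exec c s t s') :
    Frame c.modReg c.modArr s s' := by
  induction h with
  | assign s r e =>
    refine ⟨fun r' hr' => ?_, fun _ _ => rfl⟩
    exact Function.update_of_ne (by simpa [Prog.modReg] using hr') _ _
  | store s a i e =>
    refine ⟨fun _ _ => rfl, fun a' ha' => ?_⟩
    exact Function.update_of_ne (by simpa [Prog.modArr] using ha') _ _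
  | seq _ _ h₁ h₂ =>
    exact (h₁.mono (by simp +contextual [Prog.modReg]) (by simp +contextual [Prog.modArr])).trans
      (h₂.mono (by simp +contextual [Prog.modReg]) (by simp +contextual [Prog.modArr]))
  | ite_true _ _ h =>
    exact h.mono (by simp +contextual [Prog.modReg]) (by simp +contextual [Prog.modArr])
  | ite_false _ _ h =>
    exact h.mono (by simp +contextual [Prog.modReg]) (by simp +contextual [Prog.modArr])
  | loop_step _ _ _ h₁ h₂ => exact Frame.trans h₁ h₂
  | _ => exact .refl _ _ _

/-- Started in `s` with `(N + 1)`-bit memory, `c` halts within the time `c.timePoly` in a state with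
`(N + 1)`-bit memory that satisfies `Q`. -/
def WP (N : ℕ) (c : Prog) (Q : State → Prop) (s : State) : Prop :=
  s.Bounded N → ∃ t s', Exec c s t s' ∧ t ≤ c.timePoly.eval N ∧ s'.Bounded N ∧ Q s'

section Rules

variable {N : ℕ} {s : State} {Q : State → Prop}

theorem wp_mono {c : Prog} {Q' : State → Prop} (h : WP N c Q' s) (hQ : ∀ s', Q' s' → Q s') :
    WP N c Q s := fun hb =>
  let ⟨t, s', he, ht, hb', hq⟩ := h hb
  ⟨t, s', he, ht, hb', hQ s' hq⟩

theorem wp_bounded {c : Prog} (h : s.Bounded N → WP N c Q s) : WP N c Q s := fun hb => h hb hb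

/-- A postcondition may be proved under the assumption that only the variables assigned by the
program have changed. -/
theorem wp_frame {c : Prog} (R A : List ℕ) (hR : ∀ r ∈ c.modReg, r ∈ R)
    (hA : ∀ a ∈ c.modArr, a ∈ A) (h : WP N c (fun s' => Frame R A s s' → Q s') s) :
    WP N c Q s := fun hb =>
  let ⟨t, s', he, ht, hb', hq⟩ := h hb
  ⟨t, s', he, ht, hb', hq (he.frame.mono hR hA)⟩

theorem wp_skip (h : Q s) : WP N .skip Q s := fun hb =>
  ⟨1, s, .skip s, by simp [Prog.timePoly], hb, h⟩

theorem wp_assign {r : ℕ} {e : Expr} (hv : e.eval s < 2 ^ (N + 1))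
    (h : Q (s.setReg r (e.eval s))) : WP N (.assign r e) Q s := fun hb =>
  ⟨_, _, .assign s r e, by simpa [Prog.timePoly] using e.cost_le hb, hb.setReg hv, h⟩

theorem wp_store {a : ℕ} {i e : Expr} (hv : e.eval s < 2 ^ (N + 1))
    (h : Q (s.setArr a (i.eval s) (e.eval s))) : WP N (.store a i e) Q s := fun hb =>
  ⟨_, _, .store s a i e, by
    simpa [Prog.timePoly, add_mul] using add_le_add (i.cost_le hb) (e.cost_le hb),
    hb.setArr hv, h⟩

theorem wp_seq {p q : Prog} (h : WP N p (fun s' => WP N q Q s') s) : WP N (.seq p q) Q s :=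
  fun hb =>
  let ⟨_, _, he, ht, hb', hq⟩ := h hb
  let ⟨_, s'', he', ht', hb'', hq'⟩ := hq hb'
  ⟨_, s'', .seq he he', by simpa [Prog.timePoly] using add_le_add ht ht', hb'', hq'⟩

theorem wp_ite {e : Expr} {p q : Prog} (hp : e.eval s ≠ 0 → WP N p Q s)
    (hq : e.eval s = 0 → WP N q Q s) : WP N (.ite e p q) Q s := fun hb => by
  have hc := e.cost_le hb
  by_cases h : e.eval s = 0
  · obtain ⟨t, s', he, ht, hb', h'⟩ := hq h hb
    refine ⟨_, s', .ite_false h he, ?_, hb', h'⟩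
    simp only [Prog.timePoly, Polynomial.eval_add, Polynomial.eval_mul, Polynomial.eval_C,
      Polynomial.eval_X, Polynomial.eval_one]
    omega
  · obtain ⟨t, s', he, ht, hb', h'⟩ := hp h hb
    refine ⟨_, s', .ite_true h he, ?_, hb', h'⟩
    simp only [Prog.timePoly, Polynomial.eval_add, Polynomial.eval_mul, Polynomial.eval_C,
      Polynomial.eval_X, Polynomial.eval_one]
    omega

theorem wp_loop_aux {e : Expr} {p : Prog} (I : ℕ → State → Prop)
    (hstep : ∀ k s, I (k + 1) s → e.eval s ≠ 0 ∧ WP N p (I k) s)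
    (hend : ∀ s, I 0 s → e.eval s = 0 ∧ Q s) (k : ℕ) :
    ∀ s, I k s → s.Bounded N → ∃ t s', Exec (.loop e p) s t s' ∧
      t ≤ (k + 1) * (e.costFactor * (N + 1) + 1 + p.timePoly.eval N) ∧ s'.Bounded N ∧ Q s' := by
  induction k with
  | zero =>
    intro s hs hb
    refine ⟨_, s, Exec.loop_stop (hend s hs).1, ?_, hb, (hend s hs).2⟩
    have := e.cost_le hb
    omega
  | succ k ih =>
    intro s hs hb
    obtain ⟨h0, hp⟩ := hstep k s hs
    obtain ⟨t, s', he, ht, hb', h'⟩ := hp hb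
    obtain ⟨t', s'', he', ht', hb'', h''⟩ := ih s' h' hb'
    refine ⟨_, s'', .loop_step h0 he he', ?_, hb'', h''⟩
    have := e.cost_le hb
    rw [add_mul _ 1, one_mul]
    omega

/-- A loop with the variant `k`: `I k` holds when `k` passes are still to be made. -/
theorem wp_loop {e : Expr} {p : Prog} (I : ℕ → State → Prop) (k : ℕ) (hk : k ≤ N) (h0 : I k s)
    (hstep : ∀ k s, I (k + 1) s → e.eval s ≠ 0 ∧ WP N p (I k) s)
    (hend : ∀ s, I 0 s → e.eval s = 0 ∧ Q s) : WP N (.loop e p) Q s := fun hb => by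
  obtain ⟨t, s', he, ht, h⟩ := wp_loop_aux I hstep hend k s h0 hb
  refine ⟨t, s', he, ht.trans ?_, h⟩
  simp only [Prog.timePoly, Polynomial.eval_add, Polynomial.eval_mul, Polynomial.eval_C,
    Polynomial.eval_X, Polynomial.eval_one]
  gcongr

/-- `for i = 0, …, reg b - 1 do p`, with the counter in register `i`. -/
def Prog.forLoop (i b : ℕ) (p : Prog) : Prog :=
  .seq (.assign i (.const 0))
    (.loop (.sub (.reg b) (.reg i)) (.seq p (.assign i (.add (.reg i) (.const 1)))))

/-- The invariant rule for counting loops.  `I k` has to hold before the pass with counter `k`. -/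
theorem wp_for {i b : ℕ} {p : Prog} (R A : List ℕ) (I : ℕ → State → Prop)
    (hR : ∀ r ∈ p.modReg, r ∈ R) (hA : ∀ a ∈ p.modArr, a ∈ A) (hbR : b ∉ R) (hiR : i ∉ R)
    (hib : i ≠ b) (hn : s.reg b ≤ N) (h0 : I 0 (s.setReg i 0))
    (hstep : ∀ k < s.reg b, ∀ s', Frame (i :: R) A s s' → s'.reg i = k → I k s' →
      WP N p (fun s'' => Frame (i :: R) A s s'' → s''.reg i = k → I (k + 1) (s''.setReg i (k + 1)))
        s')
    (hend : ∀ s', Frame (i :: R) A s s' → I (s.reg b) s' → Q s') :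
    WP N (.forLoop i b p) Q s := by
  refine wp_seq (wp_assign (by simp [Expr.eval]) ?_)
  refine wp_loop (fun j s' => ∃ k, k + j = s.reg b ∧ Frame (i :: R) A s s' ∧ s'.reg i = k ∧ I k s')
    (s.reg b) hn ⟨0, by simp, ⟨fun r hr => ?_, fun _ _ => rfl⟩, by simp [Expr.eval],
      by simpa [Expr.eval] using h0⟩ ?_ ?_
  · rw [State.reg_setReg, if_neg (by rintro rfl; simp at hr)]
  · rintro j s' ⟨k, hk, hF, hi, hI⟩
    have hb : s'.reg b = s.reg b := hF.reg b (by simp [hbR, hib.symm])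
    refine ⟨by simp only [Expr.eval, hb, hi]; omega, wp_seq ?_⟩
    refine wp_frame R A hR hA (wp_mono (hstep k (by omega) s' hF hi hI) fun s'' h'' hF' => ?_)
    have hF2 : Frame (i :: R) A s s'' :=
      hF.trans (hF'.mono (by simp +contextual) (by simp))
    have hi' : s''.reg i = k := (hF'.reg i hiR).trans hi
    refine wp_assign ?_ ⟨k + 1, by omega, ?_, by simp [Expr.eval, hi'], ?_⟩
    · simp only [Expr.eval, hi']
      exact lt_of_le_of_lt (show k + 1 ≤ N + 1 by omega) Nat.lt_two_pow_self
    · refine ⟨fun r hr => ?_, hF2.arr⟩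
      rw [State.reg_setReg, if_neg (by rintro rfl; simp at hr), hF2.reg r hr]
    · simpa [Expr.eval, hi'] using h'' hF2 hi'
  · rintro s' ⟨k, hk, hF, hi, hI⟩
    have hb : s'.reg b = s.reg b := hF.reg b (by simp [hbR, hib.symm])
    obtain rfl : k = s.reg b := by omega
    exact ⟨by simp [Expr.eval, hb, hi], hend s' hF hI⟩

end Rules

theorem length_le_inputSize (x : List ℕ) : x.length ≤ inputSize x := by
  induction x with
  | nil => simp
  | cons a x ih =>
    simp only [inputSize, List.map_cons, List.sum_cons, List.length_cons, logCost] at *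
    omega

theorem getD_lt_inputSize (x : List ℕ) (i : ℕ) : x.getD i 0 < 2 ^ inputSize x := by
  by_cases hi : i < x.length
  · rw [List.getD_eq_getElem _ _ hi]
    refine (Nat.lt_size_self _).trans_le (Nat.pow_le_pow_right two_pos ?_)
    have : logCost x[i] ≤ inputSize x :=
      List.single_le_sum (by simp) _ (List.mem_map_of_mem (List.getElem_mem hi))
    rw [logCost] at this
    omega
  · rw [List.getD_eq_default _ _ (by omega)]
    exact Nat.two_pow_pos _

theorem bounded_init (x : List ℕ) {N : ℕ} (hN : inputSize x ≤ N + 1) :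
    (State.init x).Bounded N := by
  have h2 : 2 ^ inputSize x ≤ 2 ^ (N + 1) := Nat.pow_le_pow_right two_pos hN
  refine ⟨fun r => ?_, fun a i => ?_⟩
  · simp only [State.init]
    split_ifs
    · exact ((length_le_inputSize x).trans_lt Nat.lt_two_pow_self).trans_le h2
    · exact Nat.two_pow_pos _
  · simp only [State.init]
    split_ifs
    · exact (getD_lt_inputSize x i).trans_le h2
    · exact Nat.two_pow_pos _

end LogRAM

/-! ### Maximum independent sets in graphs of maximum degree two -/

namespace GreedyIndep

variable {α : Type*} (C : α → α → Prop)

/-- No two distinct elements of `T` are in conflict. -/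
def Indep (T : Finset α) : Prop := ∀ v ∈ T, ∀ w ∈ T, v ≠ w → ¬ C v w

/-- The invariant of the greedy algorithm on the vertex set `A₀`: the independent set `S` chosen so
far, together with a maximum independent set of the set `A` of remaining vertices, is a maximum
independent set of `A₀`. -/
structure Inv (A₀ A S : Finset α) : Prop where
  sub : A ⊆ A₀
  sel_sub : S ⊆ A₀
  indep : Indep C S
  not_mem : ∀ v ∈ S, v ∉ A
  free : ∀ v ∈ S, ∀ w ∈ A, ¬ C v w
  max : ∀ T ⊆ A₀, Indep C T → ∃ T' ⊆ A, Indep C T' ∧ T.card ≤ S.card + T'.card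

variable {C}

theorem Indep.mono {T T' : Finset α} (h : Indep C T) (hT : T' ⊆ T) : Indep C T' :=
  fun v hv w hw => h v (hT hv) w (hT hw)

theorem Inv.init (A₀ : Finset α) : Inv C A₀ A₀ ∅ where
  sub := subset_rfl
  sel_sub := by simp
  indep := by simp [Indep]
  not_mem := by simp
  free := by simp
  max T hT hI := ⟨T, hT, hI, by simp⟩

theorem Inv.card_le {A₀ S : Finset α} (h : Inv C A₀ ∅ S) {T : Finset α} (hT : T ⊆ A₀)
    (hI : Indep C T) : T.card ≤ S.card := by
  obtain ⟨T', hT', -, hc⟩ := h.max T hT hI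
  simpa [Finset.subset_empty.1 hT'] using hc

variable [DecidableEq α]

theorem Indep.insert (hC : ∀ v w, C v w → C w v) {T : Finset α} {v : α} (h : Indep C T)
    (hv : ∀ w ∈ T, w ≠ v → ¬ C v w) : Indep C (insert v T) := by
  intro x hx y hy hxy hc
  rw [Finset.mem_insert] at hx hy
  rcases hx with rfl | hx <;> rcases hy with rfl | hy
  · exact hxy rfl
  · exact hv y hy hxy.symm hc
  · exact hv x hx hxy (hC _ _ hc)
  · exact h x hx y hy hxy hc

variable (C) [DecidableRel C]

/-- The elements of `A` other than `v` that are in conflict with `v`. -/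
def nbrs (A : Finset α) (v : α) : Finset α := A.filter fun w => w ≠ v ∧ C v w

/-- What is left of `A` after `v` and its neighbours have been deleted. -/
def prune (A : Finset α) (v : α) : Finset α := A.filter fun w => w ≠ v ∧ ¬ C v w

variable {C}

theorem mem_nbrs {A : Finset α} {v w : α} : w ∈ nbrs C A v ↔ w ∈ A ∧ w ≠ v ∧ C v w := by
  simp [nbrs]

theorem mem_prune {A : Finset α} {v w : α} : w ∈ prune C A v ↔ w ∈ A ∧ w ≠ v ∧ ¬ C v w := by
  simp [prune]

theorem nbrs_sdiff_pair {H : Finset α} {v a c : α} (ha : a ∉ nbrs C H v) (hc : c ∉ nbrs C H v) :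
    nbrs C (H \ {a, c}) v = nbrs C H v := by
  ext w
  simp only [mem_nbrs, Finset.mem_sdiff, Finset.mem_insert, Finset.mem_singleton, not_or]
  refine ⟨fun h => ⟨h.1.1, h.2⟩, fun h => ⟨⟨h.1, ?_, ?_⟩, h.2⟩⟩
  · rintro rfl; exact ha (mem_nbrs.2 h)
  · rintro rfl; exact hc (mem_nbrs.2 h)

/-- If all vertices have degree two except for `a` and `b`, of degree one, then an independent set
can be changed so as to avoid both ends `a` and `b` at the loss of one element: it is shifted along
the path that starts in `a`, up to the first place where it fails to alternate, or up to `b`. -/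
theorem exists_indep_avoiding_ends (hC : ∀ v w, C v w → C w v) (n : ℕ) :
    ∀ (H : Finset α) (a b : α) (T : Finset α), H.card ≤ n → a ≠ b →
      (nbrs C H a).card = 1 → (nbrs C H b).card = 1 →
      (∀ w ∈ H, w ≠ a → w ≠ b → (nbrs C H w).card = 2) → T ⊆ H → Indep C T → a ∈ T → b ∈ T →
      ∃ T' ⊆ H, Indep C T' ∧ a ∉ T' ∧ b ∉ T' ∧ T.card ≤ T'.card + 1 := by
  induction n with
  | zero =>
    intro H a b T hH _ _ _ _ hT _ haT _
    rw [Nat.le_zero, Finset.card_eq_zero] at hH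
    subst hH
    exact absurd (hT haT) (by simp)
  | succ n ih =>
    intro H a b T hH hab ha hb h2 hT hI haT hbT
    obtain ⟨c, hc⟩ := Finset.card_eq_one.1 ha
    have hcH := mem_nbrs.1 (hc ▸ Finset.mem_singleton_self c)
    have hcb : c ≠ b := by rintro rfl; exact hI a haT _ hbT hab hcH.2.2
    have hcT : c ∉ T := fun h => hI a haT c h hcH.2.1.symm hcH.2.2
    have hac : a ∈ nbrs C H c := mem_nbrs.2 ⟨hT haT, hcH.2.1.symm, hC _ _ hcH.2.2⟩
    have hc1 : ((nbrs C H c).erase a).card = 1 := by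
      rw [Finset.card_erase_of_mem hac, h2 c hcH.1 hcH.2.1 hcb]
    obtain ⟨d, hd⟩ := Finset.card_eq_one.1 hc1
    have hd' : d ∈ (nbrs C H c).erase a := hd ▸ Finset.mem_singleton_self d
    rw [Finset.mem_erase] at hd'
    obtain ⟨hda, hdc⟩ := hd'
    have hcn : ∀ w ∈ nbrs C H c, w ≠ a → w = d := fun w hw hwa => by
      have : w ∈ (nbrs C H c).erase a := Finset.mem_erase.2 ⟨hwa, hw⟩
      rwa [hd, Finset.mem_singleton] at this
    have hdH := mem_nbrs.1 hdc
    by_cases hdT : d ∈ T ∧ d ≠ b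
    · have hsub : T.erase a ⊆ H \ {a, c} := by
        intro w hw
        rw [Finset.mem_erase] at hw
        simp only [Finset.mem_sdiff, Finset.mem_insert, Finset.mem_singleton, not_or]
        exact ⟨hT hw.2, hw.1, by rintro rfl; exact hcT hw.2⟩
      have hcard : (H \ {a, c}).card ≤ n := by
        have : (H \ {a, c}).card < H.card :=
          Finset.card_lt_card ⟨Finset.sdiff_subset, fun h => by simpa using h (hT haT)⟩
        omega
      have hna : ∀ w, w ≠ c → w ∈ H → a ∉ nbrs C H w := fun w hwc hw h => by
        rw [mem_nbrs] at h
        have : w ∈ nbrs C H a := mem_nbrs.2 ⟨hw, h.2.1.symm, hC _ _ h.2.2⟩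
        rw [hc, Finset.mem_singleton] at this
        exact hwc this
      have hnc : ∀ w, w ≠ a → w ≠ d → w ∈ H → c ∉ nbrs C H w := fun w hwa hwd hw h => by
        rw [mem_nbrs] at h
        exact hwd (hcn w (mem_nbrs.2 ⟨hw, h.2.1.symm, hC _ _ h.2.2⟩) hwa)
      obtain ⟨T', hT', hI', hd1, hb1, hcd⟩ := ih (H \ {a, c}) d b (T.erase a) hcard hdT.2
        (by
          have : nbrs C (H \ {a, c}) d = (nbrs C H d).erase c := by
            ext w
            have hw := hna d hdH.2.1 hdH.1
            simp only [mem_nbrs, Finset.mem_sdiff, Finset.mem_insert, Finset.mem_singleton, not_or,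
              Finset.mem_erase] at hw ⊢
            refine ⟨fun h => ⟨h.1.2.2, h.1.1, h.2⟩, fun h => ⟨⟨h.2.1, ?_, h.1⟩, h.2.2⟩⟩
            rintro rfl; exact hw h.2
          rw [this, Finset.card_erase_of_mem
            (mem_nbrs.2 ⟨hcH.1, hdH.2.1.symm, hC _ _ hdH.2.2⟩), h2 d hdH.1 hda hdT.2])
        (by rw [nbrs_sdiff_pair (hna b hcb.symm (hT hbT))
          (hnc b hab.symm hdT.2.symm (hT hbT)), hb])
        (fun w hw hwd hwb => by
          simp only [Finset.mem_sdiff, Finset.mem_insert, Finset.mem_singleton, not_or] at hw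
          rw [nbrs_sdiff_pair (hna w hw.2.2 hw.1) (hnc w hw.2.1 hwd hw.1),
            h2 w hw.1 hw.2.1 hwb])
        hsub (hI.mono (Finset.erase_subset _ _))
        (Finset.mem_erase.2 ⟨hda, hdT.1⟩) (Finset.mem_erase.2 ⟨hab.symm, hbT⟩)
      have hmem : ∀ w ∈ T', w ∈ H ∧ w ≠ a ∧ w ≠ c := fun w hw => by
        simpa [not_or] using hT' hw
      refine ⟨insert c T', ?_, hI'.insert hC ?_, ?_, ?_, ?_⟩
      · intro w hw
        rcases Finset.mem_insert.1 hw with rfl | hw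
        exacts [hcH.1, (hmem w hw).1]
      · intro w hw hwc hcw
        have := hcn w (mem_nbrs.2 ⟨(hmem w hw).1, hwc, hcw⟩) (hmem w hw).2.1
        exact hd1 (this ▸ hw)
      · simp only [Finset.mem_insert, not_or]
        exact ⟨hcH.2.1.symm, fun h => (hmem a h).2.1 rfl⟩
      · simp only [Finset.mem_insert, not_or]
        exact ⟨hcb.symm, hb1⟩
      · rw [Finset.card_insert_of_notMem fun h => (hmem c h).2.2 rfl]
        rw [Finset.card_erase_of_mem haT] at hcd
        omega
    · have hdT' : d ∉ (T.erase a).erase b := by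
        simp only [Finset.mem_erase, not_and]
        exact fun hdb _ hdT'' => hdT ⟨hdT'', hdb⟩
      have hmem : ∀ w ∈ (T.erase a).erase b, w ≠ b ∧ w ≠ a ∧ w ∈ T := fun w hw => by
        simpa using hw
      refine ⟨insert c ((T.erase a).erase b), ?_, Indep.insert hC
        (hI.mono ((Finset.erase_subset _ _).trans (Finset.erase_subset _ _))) ?_, ?_, ?_, ?_⟩
      · intro w hw
        rcases Finset.mem_insert.1 hw with rfl | hw
        exacts [hcH.1, hT (hmem w hw).2.2]
      · intro w hw hwc hcw
        have := hcn w (mem_nbrs.2 ⟨hT (hmem w hw).2.2, hwc, hcw⟩) (hmem w hw).2.1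
        exact hdT' (this ▸ hw)
      · simp [hcH.2.1.symm]
      · simp [hcb.symm]
      · rw [Finset.card_insert_of_notMem fun h => hcT (hmem c h).2.2,
          Finset.card_erase_of_mem (Finset.mem_erase.2 ⟨hab.symm, hbT⟩),
          Finset.card_erase_of_mem haT]
        omega

/-- A vertex `v` of degree at most one, or any vertex `v` if all degrees are two, belongs to some
maximum independent set; deleting `v` and its neighbours therefore costs just one element. -/
theorem exists_indep_prune (hC : ∀ v w, C v w → C w v) {A : Finset α} {v : α} (hv : v ∈ A)
    (h : (nbrs C A v).card ≤ 1 ∨ ∀ w ∈ A, (nbrs C A w).card = 2) {T : Finset α} (hT : T ⊆ A)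
    (hI : Indep C T) : ∃ T' ⊆ prune C A v, Indep C T' ∧ T.card ≤ T'.card + 1 := by
  have key : ∀ x, (∀ w ∈ T, w = v ∨ C v w → w = x) →
      ∃ T' ⊆ prune C A v, Indep C T' ∧ T.card ≤ T'.card + 1 := fun x hx => by
    refine ⟨T.erase x, fun w hw => ?_, hI.mono (Finset.erase_subset _ _), ?_⟩
    · rw [Finset.mem_erase] at hw
      refine mem_prune.2 ⟨hT hw.2, fun h => hw.1 (hx w hw.2 (.inl h)),
        fun h => hw.1 (hx w hw.2 (.inr h))⟩
    · have := Finset.pred_card_le_card_erase (s := T) (a := x)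
      omega
  by_cases hvT : v ∈ T
  · exact key v fun w hw h => h.elim id fun h => by_contra fun hne => hI v hvT w hw (Ne.symm hne) h
  have hvT' : ∀ w ∈ T, w ≠ v := fun w hw h => hvT (h ▸ hw)
  rcases h with h | h
  · rcases (nbrs C A v).eq_empty_or_nonempty with h0 | ⟨x, hx⟩
    · refine key v fun w hw h => h.elim id fun h => ?_
      exact absurd (mem_nbrs.2 ⟨hT hw, hvT' w hw, h⟩) (by simp [h0])
    · refine key x fun w hw h => ?_
      exact Finset.card_le_one.1 ‹_› w
        (mem_nbrs.2 ⟨hT hw, hvT' w hw, h.resolve_left (hvT' w hw)⟩) x hx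
  · obtain ⟨a, b, hab, hn⟩ := Finset.card_eq_two.1 (h v hv)
    have hcase : ∀ w ∈ T, w = v ∨ C v w → w = a ∨ w = b := fun w hw h => by
      have : w ∈ nbrs C A v := mem_nbrs.2 ⟨hT hw, hvT' w hw, h.resolve_left (hvT' w hw)⟩
      simpa [hn] using this
    by_cases haT : a ∈ T
    swap
    · refine key b fun w hw h => (hcase w hw h).resolve_left ?_
      rintro rfl; exact haT hw
    by_cases hbT : b ∈ T
    swap
    · refine key a fun w hw h => (hcase w hw h).resolve_right ?_
      rintro rfl; exact hbT hw
    -- Without `v`, its two neighbours have degree one and all other degrees are still two.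
    have herase : ∀ w, nbrs C (A.erase v) w = (nbrs C A w).erase v := fun w => by
      ext x
      simp only [mem_nbrs, Finset.mem_erase]
      tauto
    have hend : ∀ w ∈ nbrs C A v, (nbrs C (A.erase v) w).card = 1 := fun w hw => by
      rw [mem_nbrs] at hw
      rw [herase, Finset.card_erase_of_mem (mem_nbrs.2 ⟨hv, hw.2.1.symm, hC _ _ hw.2.2⟩), h w hw.1]
    obtain ⟨T', hT', hI', ha, hb, hcard⟩ := exists_indep_avoiding_ends hC _ (A.erase v) a b T
      le_rfl hab (hend a (by simp [hn])) (hend b (by simp [hn]))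
      (fun w hw hwa hwb => by
        rw [Finset.mem_erase] at hw
        rw [herase, Finset.erase_eq_of_notMem, h w hw.2]
        intro hvw
        rw [mem_nbrs] at hvw
        have : w ∈ nbrs C A v := mem_nbrs.2 ⟨hw.2, hw.1, hC _ _ hvw.2.2⟩
        simp [hn, hwa, hwb] at this)
      (fun w hw => Finset.mem_erase.2 ⟨hvT' w hw, hT hw⟩) hI haT hbT
    refine ⟨T', fun w hw => ?_, hI', hcard⟩
    have hw' := Finset.mem_erase.1 (hT' hw)
    refine mem_prune.2 ⟨hw'.2, hw'.1, fun hvw => ?_⟩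
    have : w ∈ nbrs C A v := mem_nbrs.2 ⟨hw'.2, hw'.1, hvw⟩
    rw [hn, Finset.mem_insert, Finset.mem_singleton] at this
    rcases this with rfl | rfl
    exacts [ha hw, hb hw]

theorem Inv.step (hC : ∀ v w, C v w → C w v) {A₀ A S : Finset α} (h : Inv C A₀ A S) {v : α}
    (hv : v ∈ A) (hdeg : (nbrs C A v).card ≤ 1 ∨ ∀ w ∈ A, (nbrs C A w).card = 2) :
    Inv C A₀ (prune C A v) (insert v S) where
  sub := (Finset.filter_subset _ _).trans h.sub
  sel_sub := Finset.insert_subset (h.sub hv) h.sel_sub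
  indep := h.indep.insert hC fun w hw _ hvw => h.free w hw v hv (hC _ _ hvw)
  not_mem w hw hw' := by
    rw [mem_prune] at hw'
    exact h.not_mem w ((Finset.mem_insert.1 hw).resolve_left hw'.2.1) hw'.1
  free w hw x hx := by
    rw [mem_prune] at hx
    rcases Finset.mem_insert.1 hw with rfl | hw
    exacts [hx.2.2, h.free w hw x hx.1]
  max T hT hI := by
    obtain ⟨T', hT', hI', hc⟩ := h.max T hT hI
    obtain ⟨T'', hT'', hI'', hc'⟩ := exists_indep_prune hC hv hdeg hT' hI'
    refine ⟨T'', hT'', hI'', ?_⟩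
    rw [Finset.card_insert_of_notMem fun hvS => h.not_mem v hvS hv]
    omega

theorem card_prune_lt {A : Finset α} {v : α} (hv : v ∈ A) : (prune C A v).card < A.card :=
  Finset.card_lt_card ⟨Finset.filter_subset _ _, fun h => (mem_prune.1 (h hv)).2.1 rfl⟩

end GreedyIndep

/-! ### Words and the instances they encode -/

theorem Nat.mul_add_lt_mul_of_lt {n m u v : ℕ} (hu : u < n) (hv : v < m) : u * m + v < n * m := by
  have := Nat.mul_le_mul_right m (Nat.succ_le_of_lt hu)
  rw [Nat.succ_mul] at this
  omega

theorem List.getD_flatten_ofFn {a b : ℕ} (f : Fin a → Fin b → ℕ) (i : Fin a) (j : Fin b) :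
    (List.ofFn fun i => List.ofFn (f i)).flatten.getD (i * b + j) 0 = f i j := by
  have h : (List.ofFn fun i => List.ofFn (f i)).flatten =
      List.ofFn fun p : Fin (a * b) => f p.divNat p.modNat := by
    rw [List.ofFn_mul]
    congr 2
    funext i
    congr 1
    funext j
    have hb : 0 < b := j.pos
    congr 1
    · ext
      simp [Fin.divNat, Nat.add_div_of_dvd_right, Nat.mul_div_cancel _ hb, Nat.div_eq_of_lt j.2]
    · ext
      simp [Fin.modNat, Nat.add_mod, Nat.mod_eq_of_lt j.2]
  have hb : 0 < b := j.pos
  have hlt := Nat.mul_add_lt_mul_of_lt i.2 j.2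
  rw [h, List.getD_eq_getElem _ _ (by simpa using hlt), List.getElem_ofFn]
  congr 1
  · ext
    simp [Fin.divNat, Nat.add_div_of_dvd_right, Nat.mul_div_cancel _ hb, Nat.div_eq_of_lt j.2]
  · ext
    simp [Fin.modNat, Nat.add_mod, Nat.mod_eq_of_lt j.2]

theorem List.length_flatten_ofFn {a b : ℕ} (f : Fin a → Fin b → ℕ) :
    (List.ofFn fun i => List.ofFn (f i)).flatten.length = a * b := by
  simp [List.length_flatten, List.map_ofFn, Function.comp_def]

theorem FairSetSelection.nbrL_inter_eq {I : FairSetSelection} (hd : I.maxDegree ≤ 2)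
    (S : Finset (Fin I.m)) (u : Fin I.n) :
    I.nbrL u ∩ S = ∅ ∨ ∃ v w, I.nbrL u ∩ S = {v, w} := by
  have h1 : (I.nbrL u ∩ S).card ≤ 2 :=
    (Finset.card_le_card Finset.inter_subset_left).trans
      ((Finset.le_sup (f := fun u => (I.nbrL u).card) (Finset.mem_univ u)).trans
        ((le_max_left _ _).trans hd))
  interval_cases hc : (I.nbrL u ∩ S).card
  · exact .inl (Finset.card_eq_zero.1 hc)
  · obtain ⟨v, hv⟩ := Finset.card_eq_one.1 hc
    exact .inr ⟨v, v, by simpa using hv⟩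
  · obtain ⟨v, w, -, hv⟩ := Finset.card_eq_two.1 hc
    exact .inr ⟨v, w, hv⟩

namespace FairWord

/-- The word that lists the given data of an instance in the order of `IsEncoding`. -/
def word (n m k : ℕ) (adj : Fin n → Fin m → Bool) (num den : Fin m → ℕ) : List ℕ :=
  [n, m, k] ++ (List.ofFn fun u => List.ofFn fun v => if adj u v then 1 else 0).flatten
    ++ (List.ofFn fun v => [num v, den v]).flatten

section Word

variable {n m k : ℕ} {adj : Fin n → Fin m → Bool} {num den : Fin m → ℕ} (tail : List ℕ)

theorem pairs_eq : (List.ofFn fun v => [num v, den v]) =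
    List.ofFn fun v => List.ofFn fun j : Fin 2 => if j = 0 then num v else den v := by
  congr 1

theorem length_word : (word n m k adj num den).length = 3 + n * m + m * 2 := by
  rw [word, pairs_eq, List.length_append, List.length_append, List.length_flatten_ofFn,
    List.length_flatten_ofFn]
  rfl

theorem getD_word_adj (u : Fin n) (v : Fin m) :
    (word n m k adj num den ++ tail).getD (3 + u * m + v) 0 = if adj u v then 1 else 0 := by
  have hlt := Nat.mul_add_lt_mul_of_lt u.2 v.2
  rw [List.getD_append _ _ _ _ (by rw [length_word]; omega), word, List.append_assoc,
    List.getD_append_right _ _ _ _ (by simp; omega),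
    List.getD_append _ _ _ _ (by rw [List.length_flatten_ofFn]; simp; omega),
    ← List.getD_flatten_ofFn (fun u v => if adj u v then 1 else 0) u v]
  congr 1
  simp; omega

theorem getD_word_pair (v : Fin m) (j : Fin 2) :
    (word n m k adj num den ++ tail).getD (3 + n * m + 2 * v + j) 0 =
      if j = 0 then num v else den v := by
  have := v.2
  have := j.2
  rw [List.getD_append _ _ _ _ (by rw [length_word]; omega), word, pairs_eq,
    List.getD_append_right _ _ _ _ (by
      rw [List.length_append, List.length_flatten_ofFn]; simp; omega),
    ← List.getD_flatten_ofFn (fun v (j : Fin 2) => if j = 0 then num v else den v) v j]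
  congr 1
  rw [List.length_append, List.length_flatten_ofFn]
  simp; omega

theorem getD_word_tail (i : ℕ) :
    (word n m k adj num den ++ tail).getD (3 + n * m + 2 * m + i) 0 = tail.getD i 0 := by
  rw [List.getD_append_right _ _ _ _ (by rw [length_word]; omega), length_word]
  congr 1
  omega

end Word

variable (x : List ℕ)

/-- The `i`-th letter of `x`; the letters after the end are `0`. -/
def cell (i : ℕ) : ℕ := x.getD i 0

/-- The number of vertices in `L`, as read off from the word. -/
def nn : ℕ := cell x 0

/-- The number of vertices in `R`, as read off from the word. -/
def mm : ℕ := cell x 1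

/-- The demand, as read off from the word. -/
def kk : ℕ := cell x 2

/-- The entry of the adjacency matrix, as read off from the word. -/
def adj (u v : ℕ) : ℕ := cell x (3 + u * mm x + v)

/-- The numerator of the weight of `v`.  For `v = mm x`, this is the numerator of the number that
follows the instance, if there is one. -/
def num (v : ℕ) : ℕ := cell x (3 + nn x * mm x + 2 * v)

/-- The denominator of the weight of `v`.  For `v = mm x`, this is the denominator of the number
that follows the instance, if there is one. -/
def den (v : ℕ) : ℕ := cell x (3 + nn x * mm x + 2 * v + 1)

/-- The numerator of the weight of the set `{v, w}`. -/
def pnum (v w : ℕ) : ℕ := num x v * den x w + if v = w then 0 else num x w * den x v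

/-- The denominator of the weight of the set `{v, w}`. -/
def pden (v w : ℕ) : ℕ := den x v * den x w

/-- The number of common neighbours of `v` and `w`. -/
def common (v w : ℕ) : ℕ := ∑ u ∈ Finset.range (nn x), adj x u v * adj x u w

/-- The vertices `v` and `w` have a common neighbour whose disagreement exceeds `bn / bd` if both
are selected.  The case `v = w` is meant to be included: such a vertex can never be selected. -/
def Conf (bn bd v w : ℕ) : Prop := common x v w ≠ 0 ∧ bn * pden x v w < pnum x v w * bd

instance (bn bd : ℕ) : DecidableRel (Conf x bn bd) := fun _ _ => instDecidableAnd

/-- The word encodes an instance of maximum degree at most two, followed by `D` further numbers,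
each given by a numerator and a denominator. -/
structure Valid (D : ℕ) : Prop where
  len : x.length = 3 + nn x * mm x + 2 * (mm x + D)
  one_le_k : 1 ≤ kk x
  k_le_m : kk x ≤ mm x
  adj_le : ∀ i < nn x * mm x, cell x (3 + i) ≤ 1
  den_ne : ∀ v < mm x + D, den x v ≠ 0
  deg_left : ∀ u < nn x, ((Finset.range (mm x)).filter fun v => adj x u v ≠ 0).card ≤ 2
  deg_right : ∀ v < mm x, ((Finset.range (nn x)).filter fun u => adj x u v ≠ 0).card ≤ 2

/-- The set `T` has at least `k` elements and contains no conflict for the threshold `bn / bd`. -/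
structure IsSol (bn bd : ℕ) (T : Finset ℕ) : Prop where
  sub : T ⊆ Finset.range (mm x)
  card : kk x ≤ T.card
  not_conf : ∀ v ∈ T, ∀ w ∈ T, ¬ Conf x bn bd v w

variable {x}

theorem conf_symm {bn bd v w : ℕ} (h : Conf x bn bd v w) : Conf x bn bd w v := by
  have h1 : common x w v = common x v w := by simp only [common, mul_comm]
  have h2 : pden x w v = pden x v w := mul_comm _ _
  have h3 : pnum x w v = pnum x v w := by
    rcases eq_or_ne v w with rfl | hne
    · rfl
    · simp only [pnum, if_neg hne, if_neg hne.symm, add_comm]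
  rwa [Conf, h1, h2, h3]

theorem exists_of_common_ne_zero {v w : ℕ} (h : common x v w ≠ 0) :
    ∃ u < nn x, adj x u v ≠ 0 ∧ adj x u w ≠ 0 := by
  obtain ⟨u, hu, h⟩ := Finset.exists_ne_zero_of_sum_ne_zero h
  exact ⟨u, Finset.mem_range.1 hu, left_ne_zero_of_mul h, right_ne_zero_of_mul h⟩

theorem common_ne_zero {u v w : ℕ} (hu : u < nn x) (hv : adj x u v ≠ 0) (hw : adj x u w ≠ 0) :
    common x v w ≠ 0 := fun h =>
  mul_ne_zero hv hw (Finset.sum_eq_zero_iff.1 h u (Finset.mem_range.2 hu))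

/-- The conflict graph has maximum degree at most two: there are at most two common neighbours `u`,
and each of them has at most one further neighbour. -/
theorem card_nbrs_le {D : ℕ} (h : Valid x D) (bn bd : ℕ) {v : ℕ} (hv : v < mm x) :
    (GreedyIndep.nbrs (Conf x bn bd) (Finset.range (mm x)) v).card ≤ 2 := by
  set U := (Finset.range (nn x)).filter fun u => adj x u v ≠ 0 with hU
  have hsub : GreedyIndep.nbrs (Conf x bn bd) (Finset.range (mm x)) v ⊆
      U.biUnion fun u => ((Finset.range (mm x)).filter fun w => adj x u w ≠ 0).erase v := by
    intro w hw
    rw [GreedyIndep.mem_nbrs] at hw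
    obtain ⟨u, hu, h1, h2⟩ := exists_of_common_ne_zero hw.2.2.1
    simp only [hU, Finset.mem_biUnion, Finset.mem_filter, Finset.mem_erase]
    exact ⟨u, ⟨Finset.mem_range.2 hu, h1⟩, hw.2.1, hw.1, h2⟩
  refine (Finset.card_le_card hsub).trans
    ((Finset.card_biUnion_le_card_mul _ _ 1 fun u hu => ?_).trans ?_)
  · rw [hU, Finset.mem_filter, Finset.mem_range] at hu
    rw [Finset.card_erase_of_mem (by simpa using ⟨hv, hu.2⟩)]
    have := h.deg_left u hu.1
    omega
  · simpa using h.deg_right v hv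

variable (x)

/-- The letters of the word `x` are those of an encoding of `I`. -/
structure Represents (I : FairSetSelection) : Prop where
  n_eq : nn x = I.n
  m_eq : mm x = I.m
  k_eq : kk x = I.k
  adj_eq : ∀ (u : Fin I.n) (v : Fin I.m), adj x u v = if I.adj u v then 1 else 0
  den_ne : ∀ v : Fin I.m, den x v ≠ 0
  w_eq : ∀ v : Fin I.m, I.w v = (num x v : ℚ≥0) / (den x v : ℚ≥0)

variable {x}

theorem represents_of_isEncoding {I : FairSetSelection} {y : List ℕ} (hy : I.IsEncoding y)
    (tail : List ℕ) : Represents (y ++ tail) I ∧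
      (y ++ tail).length = 3 + I.n * I.m + 2 * I.m + tail.length ∧
      ∀ i, (y ++ tail).getD (3 + I.n * I.m + 2 * I.m + i) 0 = tail.getD i 0 := by
  obtain ⟨num', den', hw, rfl⟩ := hy
  change Represents (word I.n I.m I.k I.adj num' den' ++ tail) I ∧
    (word I.n I.m I.k I.adj num' den' ++ tail).length = 3 + I.n * I.m + 2 * I.m + tail.length ∧ _
  set y := word I.n I.m I.k I.adj num' den' with hydef
  have hn : nn (y ++ tail) = I.n := rfl
  have hm : mm (y ++ tail) = I.m := rfl
  have hnum : ∀ v : Fin I.m, num (y ++ tail) v = num' v := fun v =>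
    getD_word_pair (k := I.k) (adj := I.adj) (num := num') (den := den') tail v 0
  have hden : ∀ v : Fin I.m, den (y ++ tail) v = den' v := fun v =>
    getD_word_pair (k := I.k) (adj := I.adj) (num := num') (den := den') tail v 1
  refine ⟨⟨hn, hm, rfl, fun u v => getD_word_adj tail u v, fun v => ?_, fun v => ?_⟩, ?_,
    fun i => getD_word_tail tail i⟩
  · rw [hden]; exact (hw v).1
  · rw [hden, hnum]; exact (hw v).2
  · rw [List.length_append, hydef, length_word]
    ring

theorem card_filter_range_fin {m : ℕ} (p : ℕ → Prop) [DecidablePred p] (q : Fin m → Prop)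
    [DecidablePred q] (h : ∀ v : Fin m, p v ↔ q v) :
    ((Finset.range m).filter p).card = (Finset.univ.filter q).card := by
  rw [← Finset.card_map Fin.valEmbedding]
  congr 1
  ext v
  simp only [Finset.mem_filter, Finset.mem_range, Finset.mem_map, Finset.mem_univ, true_and,
    Fin.valEmbedding_apply]
  constructor
  · rintro ⟨hv, hp⟩
    exact ⟨⟨v, hv⟩, (h ⟨v, hv⟩).1 hp, rfl⟩
  · rintro ⟨v, hq, rfl⟩
    exact ⟨v.2, (h v).2 hq⟩

theorem exists_fin_mul_add {n m i : ℕ} (hi : i < n * m) :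
    ∃ (u : Fin n) (v : Fin m), i = u * m + v := by
  have hm : 0 < m := Nat.pos_of_ne_zero (by rintro rfl; simp at hi)
  refine ⟨⟨i / m, Nat.div_lt_of_lt_mul (by rwa [mul_comm])⟩, ⟨i % m, Nat.mod_lt _ hm⟩, ?_⟩
  simp [Nat.div_add_mod']

namespace Represents

variable {I : FairSetSelection} (h : Represents x I)
include h

theorem adj_ne_zero (u : Fin I.n) (v : Fin I.m) : adj x u v ≠ 0 ↔ I.adj u v = true := by
  rw [h.adj_eq]; split_ifs <;> simp_all

theorem maxDegree_le : I.maxDegree ≤ 2 ↔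
    (∀ u < nn x, ((Finset.range (mm x)).filter fun v => adj x u v ≠ 0).card ≤ 2) ∧
      ∀ v < mm x, ((Finset.range (nn x)).filter fun u => adj x u v ≠ 0).card ≤ 2 := by
  have hL : ∀ u : Fin I.n,
      ((Finset.range I.m).filter fun v => adj x u v ≠ 0).card = (I.nbrL u).card :=
    fun u => card_filter_range_fin _ _ fun v => h.adj_ne_zero u v
  have hR : ∀ v : Fin I.m,
      ((Finset.range I.n).filter fun u => adj x u v ≠ 0).card = (I.nbrR v).card :=
    fun v => card_filter_range_fin _ _ fun u => h.adj_ne_zero u v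
  rw [FairSetSelection.maxDegree, max_le_iff, Finset.sup_le_iff, Finset.sup_le_iff, h.n_eq, h.m_eq]
  constructor
  · rintro ⟨h1, h2⟩
    exact ⟨fun u hu => (hL ⟨u, hu⟩).trans_le (h1 _ (Finset.mem_univ _)),
      fun v hv => (hR ⟨v, hv⟩).trans_le (h2 _ (Finset.mem_univ _))⟩
  · rintro ⟨h1, h2⟩
    exact ⟨fun u _ => (hL u).symm.trans_le (h1 u u.2), fun v _ => (hR v).symm.trans_le (h2 v v.2)⟩

theorem valid {D : ℕ} (hd : I.maxDegree ≤ 2) (hlen : x.length = 3 + I.n * I.m + 2 * (I.m + D))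
    (hden : ∀ v, I.m ≤ v → v < I.m + D → den x v ≠ 0) : Valid x D where
  len := by rw [hlen, h.n_eq, h.m_eq]
  one_le_k := h.k_eq ▸ I.one_le_k
  k_le_m := by rw [h.k_eq, h.m_eq]; exact I.k_le_m
  adj_le i hi := by
    rw [h.n_eq, h.m_eq] at hi
    obtain ⟨u, v, rfl⟩ := exists_fin_mul_add hi
    have := h.adj_eq u v
    rw [adj, h.m_eq, add_assoc] at this
    rw [this]
    split_ifs <;> simp
  den_ne v hv := by
    rw [h.m_eq] at hv
    rcases lt_or_ge v I.m with hvm | hvm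
    exacts [h.den_ne ⟨v, hvm⟩, hden v hvm hv]
  deg_left := (h.maxDegree_le.1 hd).1
  deg_right := (h.maxDegree_le.1 hd).2

theorem sum_pair (v w : Fin I.m) :
    ∑ i ∈ {v, w}, I.w i = (pnum x v w : ℚ≥0) / (pden x v w : ℚ≥0) := by
  have hv : (den x v : ℚ≥0) ≠ 0 := Nat.cast_ne_zero.2 (h.den_ne v)
  have hw : (den x w : ℚ≥0) ≠ 0 := Nat.cast_ne_zero.2 (h.den_ne w)
  rcases eq_or_ne v w with rfl | hne
  · simp only [Finset.pair_eq_singleton, Finset.sum_singleton, pnum, pden, if_true, add_zero,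
      h.w_eq]
    push_cast
    rw [mul_div_mul_right _ _ hv]
  · rw [Finset.sum_pair hne, pnum, pden, if_neg (fun he => hne (Fin.ext he)), h.w_eq, h.w_eq,
      div_add_div _ _ hv hw]
    push_cast
    ring

theorem pden_ne (v w : Fin I.m) : pden x v w ≠ 0 := mul_ne_zero (h.den_ne v) (h.den_ne w)

theorem not_conf_iff {bn bd : ℕ} (hbd : bd ≠ 0) (v w : Fin I.m) :
    ¬ Conf x bn bd v w ↔ ((∃ u, I.adj u v = true ∧ I.adj u w = true) →
      ∑ i ∈ {v, w}, I.w i ≤ (bn : ℚ≥0) / (bd : ℚ≥0)) := by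
  have hc : common x v w ≠ 0 ↔ ∃ u, I.adj u v = true ∧ I.adj u w = true := by
    constructor
    · intro hne
      obtain ⟨u, hu, h1, h2⟩ := exists_of_common_ne_zero hne
      rw [h.n_eq] at hu
      exact ⟨⟨u, hu⟩, (h.adj_ne_zero ⟨u, hu⟩ v).1 h1, (h.adj_ne_zero ⟨u, hu⟩ w).1 h2⟩
    · rintro ⟨u, h1, h2⟩
      exact common_ne_zero (u.2.trans_eq h.n_eq.symm)
        ((h.adj_ne_zero u v).2 h1) ((h.adj_ne_zero u w).2 h2)
  rw [Conf, hc, not_and, not_lt, h.sum_pair,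
    div_le_div_iff₀ (Nat.cast_pos.2 (Nat.pos_of_ne_zero (h.pden_ne v w)))
      (Nat.cast_pos.2 (Nat.pos_of_ne_zero hbd))]
  norm_cast

/-- Since a vertex of `L` has at most two neighbours, a bound on its disagreement is a condition on
pairs of selected vertices. -/
theorem maxDis_le_iff (hd : I.maxDegree ≤ 2) {bn bd : ℕ} (hbd : bd ≠ 0) (S : Finset (Fin I.m)) :
    I.maxDis S ≤ (bn : ℚ≥0) / (bd : ℚ≥0) ↔ ∀ v ∈ S, ∀ w ∈ S, ¬ Conf x bn bd v w := by
  rw [FairSetSelection.maxDis, Finset.sup_le_iff]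
  constructor
  · intro hS v hv w hw
    rw [h.not_conf_iff hbd]
    rintro ⟨u, hu1, hu2⟩
    refine le_trans ?_ (hS u (Finset.mem_univ u))
    refine Finset.sum_le_sum_of_subset (fun i hi => ?_)
    rw [Finset.mem_insert, Finset.mem_singleton] at hi
    simp only [Finset.mem_inter, FairSetSelection.nbrL, Finset.mem_filter, Finset.mem_univ,
      true_and]
    rcases hi with rfl | rfl
    exacts [⟨hu1, hv⟩, ⟨hu2, hw⟩]
  · intro hS u _
    rw [FairSetSelection.dis]
    rcases FairSetSelection.nbrL_inter_eq hd S u with h0 | ⟨v, w, hvw⟩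
    · simp [h0]
    · have hv : v ∈ I.nbrL u ∩ S := by simp [hvw]
      have hw : w ∈ I.nbrL u ∩ S := by simp [hvw]
      simp only [Finset.mem_inter, FairSetSelection.nbrL, Finset.mem_filter, Finset.mem_univ,
        true_and] at hv hw
      rw [hvw]
      exact (h.not_conf_iff hbd v w).1 (hS v hv.2 w hw.2) ⟨u, hv.1, hw.1⟩

theorem maxDis_eq (hd : I.maxDegree ≤ 2) (S : Finset (Fin I.m)) :
    I.maxDis S = 0 ∨ ∃ v w : Fin I.m, I.maxDis S = (pnum x v w : ℚ≥0) / (pden x v w : ℚ≥0) := by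
  rcases (Finset.univ : Finset (Fin I.n)).eq_empty_or_nonempty with h0 | h0
  · exact .inl (by rw [FairSetSelection.maxDis, h0]; simp)
  · obtain ⟨u, -, hu⟩ := Finset.exists_mem_eq_sup _ h0 (I.dis S)
    rw [FairSetSelection.maxDis, hu, FairSetSelection.dis]
    rcases FairSetSelection.nbrL_inter_eq hd S u with h0 | ⟨v, w, hvw⟩
    · exact .inl (by simp [h0])
    · exact .inr ⟨v, w, by rw [hvw, h.sum_pair]⟩

theorem isSol_map_iff (hd : I.maxDegree ≤ 2) {bn bd : ℕ} (hbd : bd ≠ 0) (S : Finset (Fin I.m)) :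
    IsSol x bn bd (S.map Fin.valEmbedding) ↔
      I.IsFeasible S ∧ I.maxDis S ≤ (bn : ℚ≥0) / (bd : ℚ≥0) := by
  rw [h.maxDis_le_iff hd hbd, FairSetSelection.IsFeasible]
  constructor
  · rintro ⟨-, h1, h2⟩
    rw [Finset.card_map, h.k_eq] at h1
    exact ⟨h1, fun v hv w hw => h2 v (Finset.mem_map_of_mem _ hv) w (Finset.mem_map_of_mem _ hw)⟩
  · rintro ⟨h1, h2⟩
    refine ⟨fun v hv => ?_, by rwa [Finset.card_map, h.k_eq], ?_⟩
    · obtain ⟨v, -, rfl⟩ := Finset.mem_map.1 hv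
      rw [h.m_eq]
      exact Finset.mem_range.2 v.2
    · intro v hv w hw
      obtain ⟨v, hv', rfl⟩ := Finset.mem_map.1 hv
      obtain ⟨w, hw', rfl⟩ := Finset.mem_map.1 hw
      exact h2 v hv' w hw'

theorem exists_map_eq {bn bd : ℕ} {T : Finset ℕ} (hT : IsSol x bn bd T) :
    ∃ S : Finset (Fin I.m), S.map Fin.valEmbedding = T ∧ ∀ v, v ∈ S ↔ (v : ℕ) ∈ T := by
  refine ⟨Finset.univ.filter fun v => (v : ℕ) ∈ T, ?_, by simp⟩
  ext v
  simp only [Finset.mem_map, Finset.mem_filter, Finset.mem_univ, true_and, Fin.valEmbedding_apply]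
  constructor
  · rintro ⟨v, hv, rfl⟩
    exact hv
  · intro hv
    have := Finset.mem_range.1 (hT.sub hv)
    rw [h.m_eq] at this
    exact ⟨⟨v, this⟩, hv, rfl⟩

end Represents

/-- Every valid word is an encoding followed by a number. -/
theorem exists_instance (h : Valid x 1) : ∃ (I : FairSetSelection) (y : List ℕ),
    Represents x I ∧ I.maxDegree ≤ 2 ∧ I.IsEncoding y ∧ x = y ++ [num x (mm x), den x (mm x)] := by
  let I : FairSetSelection :=
    { n := nn x, m := mm x, k := kk x
      adj := fun u v => decide (adj x u v ≠ 0)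
      w := fun v => (num x v : ℚ≥0) / (den x v : ℚ≥0)
      one_le_k := h.one_le_k
      k_le_m := h.k_le_m }
  have hadj : ∀ (u : Fin (nn x)) (v : Fin (mm x)), adj x u v = if I.adj u v then 1 else 0 := by
    intro u v
    have h1 : adj x u v ≤ 1 := by
      rw [adj, add_assoc]
      exact h.adj_le _ (Nat.mul_add_lt_mul_of_lt u.2 v.2)
    by_cases h0 : adj x u v = 0
    · simp [I, h0]
    · have : adj x u v = 1 := by omega
      simp [I, this]
  have hrep : Represents x I :=
    ⟨rfl, rfl, rfl, hadj, fun v => h.den_ne v (Nat.lt_add_right 1 v.2), fun v => rfl⟩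
  have henc : I.IsEncoding (word I.n I.m I.k I.adj (fun v => num x v) fun v => den x v) :=
    ⟨fun v => num x v, fun v => den x v, fun v => ⟨hrep.den_ne v, rfl⟩, rfl⟩
  refine ⟨I, _, hrep, hrep.maxDegree_le.2 ⟨h.deg_left, h.deg_right⟩, henc, ?_⟩
  set t := [num x (mm x), den x (mm x)]
  have hlen : x.length = (word I.n I.m I.k I.adj (fun v => num x v) (fun v => den x v) ++ t).length
    := by
    rw [List.length_append, length_word, h.len]
    change 3 + nn x * mm x + 2 * (mm x + 1) = 3 + nn x * mm x + mm x * 2 + 2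
    ring
  refine List.ext_getElem hlen fun i hi hi' => ?_
  rw [← List.getD_eq_getElem x 0 hi, ← List.getD_eq_getElem _ 0 hi']
  rw [h.len] at hi
  rcases lt_or_ge i 3 with h3 | h3
  · interval_cases i <;> rfl
  obtain ⟨i, rfl⟩ := Nat.exists_eq_add_of_le h3
  rcases lt_or_ge i (nn x * mm x) with h4 | h4
  · obtain ⟨u, v, rfl⟩ := exists_fin_mul_add h4
    rw [← add_assoc]
    exact (hadj u v).trans (getD_word_adj (n := I.n) (m := I.m) t u v).symm
  obtain ⟨i, rfl⟩ := Nat.exists_eq_add_of_le h4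
  rcases lt_or_ge i (mm x * 2) with h5 | h5
  · obtain ⟨v, j, rfl⟩ := exists_fin_mul_add h5
    have e : 3 + (nn x * mm x + ((v : ℕ) * 2 + j)) = 3 + nn x * mm x + 2 * v + j := by ring
    rw [e]
    refine Eq.trans ?_ (getD_word_pair (n := I.n) (m := I.m) t v j).symm
    fin_cases j <;> rfl
  obtain ⟨i, rfl⟩ := Nat.exists_eq_add_of_le h5
  have e : 3 + (nn x * mm x + (mm x * 2 + i)) = 3 + nn x * mm x + 2 * mm x + i := by ring
  rw [e]
  refine Eq.trans ?_ (getD_word_tail (n := I.n) (m := I.m) t i).symm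
  have : i < 2 := by
    have := e ▸ hi
    omega
  interval_cases i <;> rfl

end FairWord

/-! ### Elementary programs -/

namespace FairWord

open LogRAM

/-- Register `10` becomes the sum of the values of `e` for `i = 0, …, reg b - 1`. -/
def sumLoop (i b : ℕ) (e : Expr) : Prog :=
  .seq (.assign 10 (.const 0)) (.forLoop i b (.assign 10 (.add (.reg 10) e)))

/-- Register `21` becomes `0` if, for some `i = 0, …, reg b - 1`, the value of `e` after a run of
`p` is not `0`. -/
def checkLoop (i b : ℕ) (p : Prog) (e : Expr) : Prog :=
  .forLoop i b (.seq p (.ite e (.assign 21 (.const 0)) .skip))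

/-- The expression with the value `1` if `e` is non-zero, and `0` otherwise. -/
def signE (e : Expr) : Expr := .sub (.const 1) (.sub (.const 1) e)

/-- The entry of the adjacency matrix for the vertices in the registers `u` and `v`. -/
def adjE (u v : ℕ) : Expr :=
  .get 0 (.add (.add (.const 3) (.mul (.reg u) (.reg 2))) (.reg v))

/-- The numerator of the weight of the vertex in register `v`. -/
def numE (v : ℕ) : Expr := .get 0 (.add (.reg 4) (.mul (.const 2) (.reg v)))

/-- The denominator of the weight of the vertex in register `v`. -/
def denE (v : ℕ) : Expr :=
  .get 0 (.add (.add (.reg 4) (.mul (.const 2) (.reg v))) (.const 1))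

/-- The numerator of the weight of the pair of vertices in the registers `v` and `w`. -/
def pnumE (v w : ℕ) : Expr :=
  .add (.mul (numE v) (denE w))
    (.mul (signE (.add (.sub (.reg v) (.reg w)) (.sub (.reg w) (.reg v))))
      (.mul (numE w) (denE v)))

/-- The denominator of the weight of the pair of vertices in the registers `v` and `w`. -/
def pdenE (v w : ℕ) : Expr := .mul (denE v) (denE w)

/-- The position of the pair of vertices in the registers `v` and `w` in a matrix. -/
def posE (v w : ℕ) : Expr := .add (.mul (.reg v) (.reg 2)) (.reg w)

/-- Array `0` holds the word `x`, and its parameters stand in the registers `1` to `4`.  The other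
registers are used as follows: `5` and `6` hold the threshold, `7`, `8`, `9`, `13`, `14`, `15`, `16`
and `17` are loop counters, `10` is an accumulator, `11` counts the selected vertices, `12` is the
vertex to be selected next, `18`, `19` and `20` describe the best solution found so far, `21` tells
whether the word is valid, and `22` and `23` are loop bounds.  Array `1` is for the best selection,
`2` for the current one, `3` for the conflict matrix, and `4` for the vertices that are left. -/
structure Base (x : List ℕ) (s : State) : Prop where
  arr_zero : s.arr 0 = cell x
  reg_n : s.reg 1 = nn x
  reg_m : s.reg 2 = mm x
  reg_k : s.reg 3 = kk x
  reg_base : s.reg 4 = 3 + nn x * mm x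

theorem Base.frame {x : List ℕ} {R A : List ℕ} {s s' : State} (h : Base x s)
    (hF : Frame R A s s') (hR : ∀ r ∈ [1, 2, 3, 4], r ∉ R) (hA : 0 ∉ A) : Base x s' where
  arr_zero := (hF.arr 0 hA).trans h.arr_zero
  reg_n := (hF.reg 1 (hR 1 (by simp))).trans h.reg_n
  reg_m := (hF.reg 2 (hR 2 (by simp))).trans h.reg_m
  reg_k := (hF.reg 3 (hR 3 (by simp))).trans h.reg_k
  reg_base := (hF.reg 4 (hR 4 (by simp))).trans h.reg_base

namespace Base

variable {x : List ℕ} {s : State} (h : Base x s)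
include h

theorem eval_adjE (u v : ℕ) : (adjE u v).eval s = adj x (s.reg u) (s.reg v) := by
  simp [adjE, Expr.eval, h.arr_zero, h.reg_m, adj]

theorem eval_numE (v : ℕ) : (numE v).eval s = num x (s.reg v) := by
  simp [numE, Expr.eval, h.arr_zero, h.reg_base, num]

theorem eval_denE (v : ℕ) : (denE v).eval s = den x (s.reg v) := by
  simp [denE, Expr.eval, h.arr_zero, h.reg_base, den]

theorem eval_pnumE (v w : ℕ) : (pnumE v w).eval s = pnum x (s.reg v) (s.reg w) := by
  have hsign : (signE (.add (.sub (.reg v) (.reg w)) (.sub (.reg w) (.reg v)))).eval s =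
      if s.reg v = s.reg w then 0 else 1 := by
    simp only [signE, Expr.eval]
    split_ifs <;> omega
  simp only [pnumE, Expr.eval, hsign, h.eval_numE, h.eval_denE, pnum]
  split_ifs <;> simp

theorem eval_pdenE (v w : ℕ) : (pdenE v w).eval s = pden x (s.reg v) (s.reg w) := by
  simp only [pdenE, Expr.eval, h.eval_denE, pden]

theorem eval_posE (v w : ℕ) : (posE v w).eval s = s.reg v * mm x + s.reg w := by
  simp only [posE, Expr.eval, h.reg_m]

end Base

theorem lt_two_pow_succ {a N : ℕ} (h : a ≤ N + 1) : a < 2 ^ (N + 1) :=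
  h.trans_lt Nat.lt_two_pow_self

section

variable {N : ℕ} {s : State}

theorem wp_sumLoop {i b : ℕ} {e : Expr} (f : ℕ → ℕ) (hb : b ≠ i) (hb' : b ≠ 10) (hi : i ≠ 10)
    (hN : s.reg b ≤ N) (hf : ∀ k < s.reg b, f k ≤ 1)
    (he : ∀ k < s.reg b, ∀ s', Frame [i, 10] [] s s' → s'.reg i = k → e.eval s' = f k) :
    WP N (sumLoop i b e) (fun s' => s'.reg 10 = ∑ k ∈ Finset.range (s.reg b), f k) s := by
  have hle : ∀ k ≤ s.reg b, ∑ j ∈ Finset.range k, f j ≤ k := fun k hk =>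
    (Finset.sum_le_card_nsmul _ _ 1 fun j hj =>
      hf j ((Finset.mem_range.1 hj).trans_le hk)).trans (by simp)
  refine wp_seq (wp_assign (by simp [Expr.eval]) ?_)
  refine wp_for [10] [] (fun k s' => s'.reg 10 = ∑ j ∈ Finset.range k, f j)
    (by simp [Prog.modReg]) (by simp [Prog.modArr]) (by simp [hb']) (by simp [hi]) hb.symm
    (by simpa [hb'] using hN) (by simp [Expr.eval, hi.symm]) ?_ ?_
  · intro k hk s' hF hik hI
    simp only [State.reg_setReg, if_neg hb'] at hk
    have hev : (Expr.add (.reg 10) e).eval s' = ∑ j ∈ Finset.range (k + 1), f j := by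
      rw [Finset.sum_range_succ, ← hI]
      simp only [Expr.eval]
      rw [he k hk s' ?_ hik]
      exact (Frame.setReg s (by simp) _).trans hF
    refine wp_assign ?_ fun _ _ => ?_
    · rw [hev]
      exact lt_two_pow_succ ((hle (k + 1) hk).trans (by omega))
    · simp [hi.symm, hev]
  · intro s' _ hI
    simpa [hb'] using hI

theorem wp_checkLoop {i b : ℕ} {p : Prog} {e : Expr} (R : List ℕ) (P : ℕ → Prop)
    (hR : ∀ r ∈ p.modReg, r ∈ R) (hA : ∀ a ∈ p.modArr, a ∈ []) (hbR : b ∉ R) (hiR : i ∉ R)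
    (hib : i ≠ b) (hb : b ≠ 21) (hi : i ≠ 21) (h21 : 21 ∉ R) (hN : s.reg b ≤ N)
    (hp : ∀ k < s.reg b, ∀ s', Frame (i :: 21 :: R) [] s s' → s'.reg i = k →
      WP N p (fun s'' => e.eval s'' = 0 ↔ P k) s') :
    WP N (checkLoop i b p e)
      (fun s' => s'.reg 21 ≠ 0 ↔ s.reg 21 ≠ 0 ∧ ∀ k < s.reg b, P k) s := by
  refine wp_for (21 :: R) [] (fun k s' => s'.reg 21 ≠ 0 ↔ s.reg 21 ≠ 0 ∧ ∀ j < k, P j)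
    ?_ ?_ (by simp [hb, hbR]) (by simp [hi, hiR]) hib hN (by simp [hi.symm]) ?_ ?_
  · intro r hr
    simp only [Prog.modReg, List.mem_append, List.mem_singleton, List.not_mem_nil, or_false] at hr
    rcases hr with hr | rfl
    exacts [List.mem_cons_of_mem _ (hR r hr), List.mem_cons_self]
  · simpa [Prog.modArr] using hA
  · intro k hk s' hF hik hI
    refine wp_seq (wp_frame R [] hR hA (wp_mono (hp k hk s' hF hik) fun s'' h'' hF' => ?_))
    have h21' : s''.reg 21 = s'.reg 21 := hF'.reg 21 h21
    rw [Nat.forall_lt_succ_right (p := P), ← and_assoc, ← hI]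
    refine wp_ite (fun h => wp_assign (by simp [Expr.eval]) fun _ _ => ?_)
      (fun h => wp_skip fun _ _ => ?_)
    · simp only [State.reg_setReg, if_neg hi.symm, if_true, Expr.eval, ne_eq, not_true_eq_false,
        false_iff, not_and]
      exact fun _ hP => h (h''.2 hP)
    · simp only [State.reg_setReg, if_neg hi.symm, h21', ne_eq]
      exact (and_iff_left (h''.1 h)).symm
  · exact fun s' _ hI => hI

end

end FairWord

/-! ### The conflict matrix and the greedy algorithm as programs -/

namespace FairWord

open LogRAM

/-- The bound `N` is large enough for the loops and the numbers that occur on the input `x`. -/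
structure Fits (x : List ℕ) (N : ℕ) : Prop where
  n_le : nn x ≤ N
  m_lt : mm x + 1 ≤ N
  nm_le : nn x * mm x ≤ N
  pnum_lt : ∀ v w, pnum x v w < 2 ^ (N + 1)
  pden_lt : ∀ v w, pden x v w < 2 ^ (N + 1)

/-- Array `3` becomes the conflict matrix for the threshold `reg 5 / reg 6`. -/
def confProg : Prog :=
  .forLoop 7 2 (.forLoop 8 2 (.seq (sumLoop 9 1 (.mul (adjE 9 7) (adjE 9 8)))
    (.store 3 (posE 7 8) (signE (.mul (.reg 10)
      (.sub (.mul (pnumE 7 8) (.reg 6)) (.mul (.reg 5) (pdenE 7 8))))))))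

/-- Initially, array `4` marks the vertices that are not in conflict with themselves, and no vertex
is selected in array `2`. -/
def initProg : Prog :=
  .seq (.assign 11 (.const 0))
    (.forLoop 7 2 (.seq (.store 4 (.reg 7) (.sub (.const 1) (.get 3 (posE 7 7))))
      (.store 2 (.reg 7) (.const 0))))

/-- Register `12` becomes `v + 1`, where `v` is the next vertex that the greedy algorithm selects,
or `0` if there is no vertex left. -/
def pickProg : Prog :=
  .seq (.assign 12 (.const 0))
    (.forLoop 14 2 (.seq (sumLoop 15 2 (.mul (.get 4 (.reg 15)) (.get 3 (posE 14 15))))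
      (.ite (.mul (.get 4 (.reg 14))
          (.add (.sub (.const 1) (.reg 12)) (.sub (.const 2) (.reg 10))))
        (.assign 12 (.add (.reg 14) (.const 1))) .skip)))

/-- The vertex `reg 12 - 1` is selected, and it is deleted together with its neighbours. -/
def selectProg : Prog :=
  .seq (.assign 12 (.sub (.reg 12) (.const 1)))
    (.seq (.assign 11 (.add (.reg 11) (.const 1)))
      (.seq (.store 2 (.reg 12) (.const 1))
        (.seq (.store 4 (.reg 12) (.const 0))
          (.forLoop 14 2 (.store 4 (.reg 14)
            (.mul (.get 4 (.reg 14)) (.sub (.const 1) (.get 3 (posE 12 14)))))))))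

/-- For the threshold `reg 5 / reg 6`, array `2` becomes the indicator vector of a maximum
conflict-free set of vertices, and register `11` its number of elements. -/
def solveProg : Prog :=
  .seq confProg (.seq initProg (.forLoop 13 2 (.seq pickProg (.ite (.reg 12) selectProg .skip))))

theorem Valid.adj_le_one {x : List ℕ} {D u v : ℕ} (h : Valid x D) (hu : u < nn x) (hv : v < mm x) :
    adj x u v ≤ 1 := by
  rw [adj, add_assoc]
  exact h.adj_le _ (Nat.mul_add_lt_mul_of_lt hu hv)

theorem mul_add_inj {m a b c d : ℕ} (hb : b < m) (hd : d < m) (h : a * m + b = c * m + d) :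
    a = c ∧ b = d := by
  have hm : 0 < m := by omega
  have h1 := congrArg (· / m) h
  have h2 := congrArg (· % m) h
  simpa [Nat.add_div_of_dvd_right, Nat.mul_div_cancel _ hm, Nat.div_eq_of_lt, hb, hd, Nat.add_mod,
    Nat.mod_eq_of_lt] using And.intro h1 h2

/-- Array `a` holds the indicator vector of `T` in its first `m` cells. -/
def Marks (m a : ℕ) (T : Finset ℕ) (s : State) : Prop :=
  ∀ v < m, s.arr a v = if v ∈ T then 1 else 0

variable {x : List ℕ} {N : ℕ} {s : State}

theorem wp_confProg {D : ℕ} (hV : Valid x D) (hN : Fits x N) (hs : Base x s) :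
    WP N confProg (fun s' => ∀ v < mm x, ∀ w < mm x, s'.arr 3 (v * mm x + w) =
      if Conf x (s.reg 5) (s.reg 6) v w then 1 else 0) s := by
  have hm := hN.m_lt
  refine wp_for [8, 9, 10] [3] (fun k s' => ∀ v < k, ∀ w < mm x, s'.arr 3 (v * mm x + w) =
      if Conf x (s.reg 5) (s.reg 6) v w then 1 else 0) (by decide) (by decide) (by decide)
      (by decide) (by decide) (by rw [hs.reg_m]; omega) (by simp) ?_ (by simp [hs.reg_m])
  intro k hk s₁ hF₁ hk₁ hI₁
  have hs₁ := hs.frame hF₁ (by decide) (by decide)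
  rw [hs.reg_m] at hk
  refine wp_for [9, 10] [3] (fun j s' => ∀ v w, (v < k ∧ w < mm x) ∨ (v = k ∧ w < j) →
      s'.arr 3 (v * mm x + w) = if Conf x (s.reg 5) (s.reg 6) v w then 1 else 0)
      (by decide) (by decide) (by decide) (by decide) (by decide) (by rw [hs₁.reg_m]; omega)
      ?_ ?_ ?_
  · rintro v w (h | ⟨-, h⟩)
    exacts [hI₁ v h.1 w h.2, absurd h (by simp)]
  · intro j hj s₂ hF₂ hj₂ hI₂
    have hs₂ := hs₁.frame hF₂ (by decide) (by decide)
    rw [hs₁.reg_m] at hj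
    have hk₂ : s₂.reg 7 = k := (hF₂.reg 7 (by decide)).trans hk₁
    refine wp_seq (wp_frame [9, 10] [] (by decide) (by decide) (wp_mono
      (wp_sumLoop (fun u => adj x u k * adj x u j) (by decide) (by decide) (by decide)
        (by rw [hs₂.reg_n]; exact hN.n_le) (fun u hu => ?_) (fun u _ s₃ hF₃ hu => ?_)) ?_))
    · rw [hs₂.reg_n] at hu
      exact Nat.mul_le_mul (hV.adj_le_one hu hk) (hV.adj_le_one hu hj)
    · have hs₃ := hs₂.frame hF₃ (by decide) (by decide)
      simp only [Expr.eval, hs₃.eval_adjE, hu, hF₃.reg 7 (by decide), hF₃.reg 8 (by decide), hk₂,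
        hj₂]
    · intro s₃ hsum hF₃
      have hs₃ := hs₂.frame hF₃ (by decide) (by decide)
      have h5 : s₃.reg 5 = s.reg 5 := by
        rw [hF₃.reg 5 (by decide), hF₂.reg 5 (by decide), hF₁.reg 5 (by decide)]
      have h6 : s₃.reg 6 = s.reg 6 := by
        rw [hF₃.reg 6 (by decide), hF₂.reg 6 (by decide), hF₁.reg 6 (by decide)]
      have h7 : s₃.reg 7 = k := (hF₃.reg 7 (by decide)).trans hk₂
      have h8 : s₃.reg 8 = j := (hF₃.reg 8 (by decide)).trans hj₂
      have hc : s₃.reg 10 = common x k j := by rw [hsum, hs₂.reg_n, common]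
      have hev : (signE (.mul (.reg 10)
          (.sub (.mul (pnumE 7 8) (.reg 6)) (.mul (.reg 5) (pdenE 7 8))))).eval s₃ =
          if Conf x (s.reg 5) (s.reg 6) k j then 1 else 0 := by
        simp only [signE, Expr.eval, hs₃.eval_pnumE, hs₃.eval_pdenE, h5, h6, h7, h8, hc]
        split_ifs with h
        · have := Nat.mul_pos (Nat.pos_of_ne_zero h.1) (Nat.sub_pos_of_lt h.2)
          omega
        · rw [Conf, not_and_or, not_not, not_lt] at h
          rcases h with h | h
          · simp [h]
          · simp [Nat.sub_eq_zero_of_le h]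
      refine wp_store ?_ fun _ _ v w hvw => ?_
      · rw [hev]
        split_ifs <;> simp
      · rw [hev, hs₃.eval_posE, h7, h8]
        simp only [State.arr_setReg, State.arr_setArr, if_true, Function.update_apply,
          hF₃.arr 3 (by decide)]
        by_cases hp : v = k ∧ w = j
        · rw [hp.1, hp.2, if_pos rfl]
        · rw [if_neg, hI₂ v w (by omega)]
          intro he
          exact hp (mul_add_inj (by omega) hj he)
  · intro s₂ _ hI₂ _ _ v hv w hw
    rw [hs₁.reg_m] at hI₂
    exact hI₂ v w (by omega)

/-- The vertices that can be selected at all. -/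
def alive₀ (x : List ℕ) (bn bd : ℕ) : Finset ℕ :=
  (Finset.range (mm x)).filter fun v => ¬ Conf x bn bd v v

theorem wp_initProg (hN : Fits x N) (hs : Base x s) {bn bd : ℕ}
    (hC : ∀ v < mm x, ∀ w < mm x, s.arr 3 (v * mm x + w) = if Conf x bn bd v w then 1 else 0) :
    WP N initProg (fun s' => s'.reg 11 = 0 ∧ Marks (mm x) 4 (alive₀ x bn bd) s' ∧
      Marks (mm x) 2 ∅ s') s := by
  have hm := hN.m_lt
  refine wp_seq (wp_assign (by simp [Expr.eval]) ?_)
  have hs₀ := hs.frame (Frame.setReg (R := [11]) (A := []) s (List.mem_singleton_self 11)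
    ((Expr.const 0).eval s)) (by decide) (by decide)
  refine wp_for [] [4, 2] (fun k s' => s'.reg 11 = 0 ∧ Marks k 4 (alive₀ x bn bd) s' ∧
    Marks k 2 ∅ s') (by decide) (by decide) (by decide)
      (by decide) (by decide) (by rw [hs₀.reg_m]; omega) (by simp [Marks, Expr.eval]) ?_
      (by rw [hs₀.reg_m]; exact fun s' _ h => h)
  intro k hk s₁ hF₁ hk₁ ⟨h11, h4, h2⟩
  have hs₁ := hs₀.frame hF₁ (by decide) (by decide)
  rw [hs₀.reg_m] at hk
  have hev : (Expr.sub (.const 1) (.get 3 (posE 7 7))).eval s₁ =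
      if k ∈ alive₀ x bn bd then 1 else 0 := by
    simp only [Expr.eval, hs₁.eval_posE, hk₁, hF₁.arr 3 (by decide), State.arr_setReg, hC k hk k hk,
      alive₀, Finset.mem_filter, Finset.mem_range, hk, true_and]
    split_ifs <;> rfl
  refine wp_seq (wp_store ?_ (wp_store (by simp [Expr.eval]) fun _ _ => ⟨?_, ?_, ?_⟩))
  · rw [hev]
    split_ifs <;> simp
  · simpa using h11
  · intro v hv
    rw [hev]
    rcases eq_or_ne v k with rfl | hne
    · simp [Expr.eval, hk₁]
    · simp [Expr.eval, hk₁, hne, h4 v (by omega)]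
  · intro v hv
    rcases eq_or_ne v k with rfl | hne
    · simp [Expr.eval, hk₁]
    · simpa [Expr.eval, hk₁, Function.update_apply, hne] using h2 v (by omega)

/-- The vertex that `pickProg` finds has at most one neighbour, if there is such a vertex. -/
theorem wp_pickProg (hN : Fits x N) (hs : Base x s) {bn bd : ℕ} {A : Finset ℕ}
    (hC : ∀ v < mm x, ∀ w < mm x, s.arr 3 (v * mm x + w) = if Conf x bn bd v w then 1 else 0)
    (hA : Marks (mm x) 4 A s) (hsub : A ⊆ alive₀ x bn bd) :
    WP N pickProg (fun s' => s'.reg 12 = 0 ∧ A = ∅ ∨ ∃ v ∈ A, s'.reg 12 = v + 1 ∧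
      ((GreedyIndep.nbrs (Conf x bn bd) A v).card ≤ 1 ∨
        ∀ w ∈ A, 2 ≤ (GreedyIndep.nbrs (Conf x bn bd) A w).card)) s := by
  have hm := hN.m_lt
  have hlt : ∀ v ∈ A, v < mm x := fun v hv =>
    Finset.mem_range.1 (Finset.mem_filter.1 (hsub hv)).1
  refine wp_seq (wp_assign (by simp [Expr.eval]) ?_)
  have hF₀ := Frame.setReg (R := [12]) (A := []) s (List.mem_singleton_self 12)
    ((Expr.const 0).eval s)
  have hs₀ := hs.frame hF₀ (by decide) (by decide)
  refine wp_for [12, 15, 10] [] (fun k s' => (s'.reg 12 = 0 ∧ ∀ v ∈ A, k ≤ v) ∨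
    ∃ v ∈ A, s'.reg 12 = v + 1 ∧ ((GreedyIndep.nbrs (Conf x bn bd) A v).card ≤ 1 ∨
        ∀ w ∈ A, w < k → 2 ≤ (GreedyIndep.nbrs (Conf x bn bd) A w).card))
      (by decide) (by decide) (by decide)
      (by decide) (by decide) (by rw [hs₀.reg_m]; omega) (by simp [Expr.eval]) ?_ ?_
  · intro k hk s₁ hF₁ hk₁ hI
    have hs₁ := hs₀.frame hF₁ (by decide) (by decide)
    rw [hs₀.reg_m] at hk
    have h4 : s₁.arr 4 = s.arr 4 := hF₁.arr 4 (by decide)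
    have h3 : s₁.arr 3 = s.arr 3 := hF₁.arr 3 (by decide)
    refine wp_seq (wp_frame [15, 10] [] (by decide) (by decide) (wp_mono
      (wp_sumLoop (fun w => if w ∈ A ∧ Conf x bn bd k w then 1 else 0) (by decide) (by decide)
        (by decide) (by rw [hs₁.reg_m]; omega) (fun u hu => by split_ifs <;> simp)
        (fun w hw s₂ hF₂ hw₂ => ?_)) ?_))
    · have hs₂ := hs₁.frame hF₂ (by decide) (by decide)
      rw [hs₁.reg_m] at hw
      simp only [Expr.eval, hs₂.eval_posE, hw₂, hF₂.reg 14 (by decide), hk₁,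
        hF₂.arr 4 (by decide), hF₂.arr 3 (by decide), h3, h4, hA w hw, hC k hk w hw, ite_and]
      split_ifs <;> rfl
    · intro s₂ hsum hF₂
      have h14 : s₂.reg 14 = k := (hF₂.reg 14 (by decide)).trans hk₁
      have h12 : s₂.reg 12 = s₁.reg 12 := hF₂.reg 12 (by decide)
      have h4k : s₂.arr 4 k = if k ∈ A then 1 else 0 := by
        rw [hF₂.arr 4 (by decide), h4, hA k hk]
      have hdeg : k ∈ A → s₂.reg 10 = (GreedyIndep.nbrs (Conf x bn bd) A k).card := by
        intro hkA
        rw [hsum, hs₁.reg_m, ← Finset.card_filter]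
        congr 1
        ext w
        simp only [Finset.mem_filter, Finset.mem_range, GreedyIndep.mem_nbrs]
        constructor
        · rintro ⟨-, hw, hc⟩
          -- A vertex that is left is not in conflict with itself.
          refine ⟨hw, ?_, hc⟩
          rintro rfl
          exact (Finset.mem_filter.1 (hsub hw)).2 hc
        · rintro ⟨hw, -, hc⟩
          exact ⟨hlt w hw, hw, hc⟩
      refine wp_ite (fun h => ?_) (fun h => wp_skip fun _ _ => ?_)
      · have hkA : k ∈ A := by
          by_contra hkA
          simp [Expr.eval, h14, h4k, hkA] at h
        refine wp_assign (lt_two_pow_succ (by simp only [Expr.eval, h14]; omega)) fun _ _ => ?_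
        refine .inr ⟨k, hkA, by simp [Expr.eval, h14], ?_⟩
        by_cases hd : (GreedyIndep.nbrs (Conf x bn bd) A k).card ≤ 1
        · exact .inl hd
        · simp only [Expr.eval, h14, h4k, hkA, if_true, h12, hdeg hkA] at h
          rcases hI with ⟨-, hI⟩ | ⟨v, -, hI, -⟩
          · refine .inr fun w hw hwk => ?_
            obtain rfl : w = k := by have := hI w hw; omega
            omega
          · omega
      · simp only [State.reg_setReg, show (12 : ℕ) ≠ 14 by decide, if_false, h12]
        by_cases hkA : k ∈ A
        · simp only [Expr.eval, h14, h4k, hkA, if_true, h12, hdeg hkA] at h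
          rcases hI with ⟨hI, -⟩ | ⟨v, hv, hI, hI'⟩
          · omega
          · refine .inr ⟨v, hv, hI, hI'.imp_right fun hI' w hw hwk => ?_⟩
            rcases Nat.lt_succ_iff_lt_or_eq.1 hwk with hwk | rfl
            · exact hI' w hw hwk
            · omega
        · have hne : ∀ w ∈ A, w ≠ k := fun w hw he => hkA (he ▸ hw)
          refine hI.imp (fun hI => ⟨hI.1, fun v hv => ?_⟩) ?_
          · have := hI.2 v hv
            have := hne v hv
            omega
          · rintro ⟨v, hv, hI, hI'⟩
            refine ⟨v, hv, hI, hI'.imp_right fun hI' w hw hwk => hI' w hw ?_⟩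
            have := hne w hw
            omega
  · rw [hs₀.reg_m]
    intro s₁ _ hI
    refine hI.imp (fun hI => ⟨hI.1, ?_⟩) ?_
    · refine Finset.eq_empty_of_forall_notMem fun v hv => ?_
      have := hlt v hv
      have := hI.2 v hv
      omega
    · rintro ⟨v, hv, hI, hI'⟩
      exact ⟨v, hv, hI, hI'.imp_right fun hI' w hw => hI' w hw (hlt w hw)⟩

theorem wp_selectProg (hN : Fits x N) (hs : Base x s) {bn bd : ℕ} {A S : Finset ℕ} {v : ℕ}
    (hC : ∀ v < mm x, ∀ w < mm x, s.arr 3 (v * mm x + w) = if Conf x bn bd v w then 1 else 0)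
    (hA : Marks (mm x) 4 A s) (hS : Marks (mm x) 2 S s) (hc : s.reg 11 = S.card)
    (hSm : S.card ≤ mm x) (hv : v < mm x) (hvS : v ∉ S) (h12 : s.reg 12 = v + 1) :
    WP N selectProg (fun s' => Marks (mm x) 4 (GreedyIndep.prune (Conf x bn bd) A v) s' ∧
      Marks (mm x) 2 (insert v S) s' ∧ s'.reg 11 = (insert v S).card) s := by
  have hm := hN.m_lt
  have he : (Expr.sub (.reg 12) (.const 1)).eval s = v := by simp [Expr.eval, h12]
  refine wp_seq (wp_assign (lt_two_pow_succ (by rw [he]; omega)) ?_)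
  rw [he]
  refine wp_seq (wp_assign (lt_two_pow_succ (by simp [Expr.eval, hc]; omega)) ?_)
  refine wp_seq (wp_store (by simp [Expr.eval]) ?_)
  refine wp_seq (wp_store (by simp [Expr.eval]) ?_)
  simp only [Expr.eval, State.reg_setReg, State.reg_setArr, if_true, hc,
    show (12 : ℕ) ≠ 11 by decide, show (11 : ℕ) ≠ 12 by decide, if_false]
  set s₀ := (((s.setReg 12 v).setReg 11 (S.card + 1)).setArr 2 v 1).setArr 4 v 0 with hs₀def
  have hF₀ : Frame [12, 11] [2, 4] s s₀ := by
    refine ⟨fun r hr => ?_, fun a ha => ?_⟩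
    · simp only [List.mem_cons, List.not_mem_nil, or_false, not_or] at hr
      simp [hs₀def, hr.1, hr.2]
    · simp only [List.mem_cons, List.not_mem_nil, or_false, not_or] at ha
      simp [hs₀def, ha.1, ha.2]
  have hs₀ := hs.frame hF₀ (by decide) (by decide)
  have h12₀ : s₀.reg 12 = v := by simp [hs₀def]
  have h11₀ : s₀.reg 11 = (insert v S).card := by
    simp [hs₀def, Finset.card_insert_of_notMem hvS]
  have hS₀ : Marks (mm x) 2 (insert v S) s₀ := by
    intro w hw
    rcases eq_or_ne w v with rfl | hne
    · simp [hs₀def]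
    · simp [hs₀def, hne, hS w hw]
  have hA₀ : Marks (mm x) 4 (A.erase v) s₀ := by
    intro w hw
    rcases eq_or_ne w v with rfl | hne
    · simp [hs₀def]
    · simp [hs₀def, hne, hA w hw]
  refine wp_for [] [4] (fun k s' => ∀ w < mm x, s'.arr 4 w =
      if w ∈ A.erase v ∧ (w < k → ¬ Conf x bn bd v w) then 1 else 0) (by decide) (by decide)
      (by decide) (by decide) (by decide) (by rw [hs₀.reg_m]; omega) (by simpa [Marks] using hA₀)
      ?_ ?_
  · intro k hk s₁ hF₁ hk₁ hI
    have hs₁ := hs₀.frame hF₁ (by decide) (by decide)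
    rw [hs₀.reg_m] at hk
    have hev : (Expr.mul (.get 4 (.reg 14)) (.sub (.const 1) (.get 3 (posE 12 14)))).eval s₁ =
        if k ∈ A.erase v ∧ ¬ Conf x bn bd v k then 1 else 0 := by
      simp only [Expr.eval, hs₁.eval_posE, hk₁, hF₁.reg 12 (by decide), h12₀,
        hF₁.arr 3 (by decide), hF₀.arr 3 (by decide), hC v hv k hk, hI k hk, lt_irrefl,
        false_imp_iff, and_true, ite_and]
      split_ifs <;> rfl
    refine wp_store ?_ fun _ _ w hw => ?_
    · rw [hev]
      split_ifs <;> simp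
    · rw [hev]
      rcases eq_or_ne w k with rfl | hne
      · simp [Expr.eval, hk₁]
      · have : w < k + 1 ↔ w < k := by omega
        simp only [State.arr_setReg, State.arr_setArr, if_true, Expr.eval, hk₁,
          Function.update_apply, hne, if_false, hI w hw, this]
  · rw [hs₀.reg_m]
    intro s₁ hF₁ hI
    refine ⟨fun w hw => ?_, fun w hw => ?_, ?_⟩
    · rw [hI w hw]
      simp only [Finset.mem_erase, hw, true_imp_iff, GreedyIndep.mem_prune]
      congr 1
      exact propext (by tauto)
    · rw [hF₁.arr 2 (by decide), hS₀ w hw]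
    · rw [hF₁.reg 11 (by decide), h11₀]

/-- The state after `solveProg`: array `2` marks a conflict-free set `S` whose number of elements
stands in register `11`, and it is a solution if there is any. -/
def Solved (x : List ℕ) (bn bd : ℕ) (s : State) : Prop :=
  ∃ S : Finset ℕ, Marks (mm x) 2 S s ∧ (kk x ≤ s.reg 11 → IsSol x bn bd S) ∧
    s.reg 11 ≤ mm x ∧ ((∃ T, IsSol x bn bd T) → kk x ≤ s.reg 11)

theorem wp_solveProg {D : ℕ} (hV : Valid x D) (hN : Fits x N) (hs : Base x s) :
    WP N solveProg (Solved x (s.reg 5) (s.reg 6)) s := by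
  have hm := hN.m_lt
  set bn := s.reg 5
  set bd := s.reg 6
  refine wp_seq (wp_frame [7, 8, 9, 10] [3] (by decide) (by decide)
    (wp_mono (wp_confProg hV hN hs) fun s₁ hC₁ hF₁ => ?_))
  have hs₁ := hs.frame hF₁ (by decide) (by decide)
  refine wp_seq (wp_frame [11, 7] [4, 2] (by decide) (by decide)
    (wp_mono (wp_initProg hN hs₁ hC₁) fun s₂ h₂ hF₂ => ?_))
  have hs₂ := hs₁.frame hF₂ (by decide) (by decide)
  obtain ⟨h11, h4, h2⟩ := h₂
  have hcard : ∀ T ⊆ alive₀ x bn bd, T.card ≤ mm x := fun T hT => by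
    simpa using Finset.card_le_card (hT.trans (Finset.filter_subset _ _))
  refine wp_for [12, 14, 15, 10, 11] [4, 2] (fun t s' => ∃ A S : Finset ℕ,
      GreedyIndep.Inv (Conf x bn bd) (alive₀ x bn bd) A S ∧ A.card ≤ mm x - t ∧
      Marks (mm x) 4 A s' ∧ Marks (mm x) 2 S s' ∧ s'.reg 11 = S.card) (by decide) (by decide)
      (by decide) (by decide) (by decide) (by rw [hs₂.reg_m]; omega)
      ⟨alive₀ x bn bd, ∅, .init _, hcard _ subset_rfl, h4, h2, by simpa using h11⟩ ?_ ?_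
  · rintro t ht s₃ hF₃ - ⟨A, S, hI, hAc, hA, hS, hSc⟩
    have hs₃ := hs₂.frame hF₃ (by decide) (by decide)
    have hC₃ : ∀ v < mm x, ∀ w < mm x,
        s₃.arr 3 (v * mm x + w) = if Conf x bn bd v w then 1 else 0 := by
      rw [hF₃.arr 3 (by decide), hF₂.arr 3 (by decide)]
      exact hC₁
    refine wp_seq (wp_frame [12, 14, 15, 10] [] (by decide) (by decide)
      (wp_mono (wp_pickProg hN hs₃ hC₃ hA hI.sub) fun s₄ h₄ hF₄ => ?_))
    have hs₄ := hs₃.frame hF₄ (by decide) (by decide)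
    have hA₄ : Marks (mm x) 4 A s₄ := by rwa [Marks, hF₄.arr 4 (by decide)]
    have hS₄ : Marks (mm x) 2 S s₄ := by rwa [Marks, hF₄.arr 2 (by decide)]
    have hSc₄ : s₄.reg 11 = S.card := by rw [hF₄.reg 11 (by decide), hSc]
    rcases h₄ with ⟨h12, rfl⟩ | ⟨v, hvA, h12, hdeg⟩
    · exact wp_ite (fun h => absurd h12 h) fun _ => wp_skip fun _ _ =>
        ⟨∅, S, hI, by simp, hA₄, hS₄, by simpa using hSc₄⟩
    · have hdeg' : (GreedyIndep.nbrs (Conf x bn bd) A v).card ≤ 1 ∨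
          ∀ w ∈ A, (GreedyIndep.nbrs (Conf x bn bd) A w).card = 2 := by
        refine hdeg.imp_right fun h w hw => le_antisymm ?_ (h w hw)
        have hsub : A ⊆ Finset.range (mm x) := hI.sub.trans (Finset.filter_subset _ _)
        exact (Finset.card_le_card (Finset.filter_subset_filter _ hsub)).trans
          (card_nbrs_le hV bn bd (Finset.mem_range.1 (hsub hw)))
      refine wp_ite (fun _ => ?_) fun h => absurd h (by simp [Expr.eval, h12])
      refine wp_mono (wp_selectProg hN hs₄ (by rwa [hF₄.arr 3 (by decide)]) hA₄ hS₄ hSc₄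
        (hcard S hI.sel_sub) (Finset.mem_range.1 (Finset.mem_filter.1 (hI.sub hvA)).1)
        (fun hvS => hI.not_mem v hvS hvA) h12) fun s₅ h₅ _ _ => ?_
      refine ⟨GreedyIndep.prune (Conf x bn bd) A v, insert v S,
        hI.step (fun _ _ => conf_symm) hvA hdeg', ?_, h₅.1, h₅.2.1, by simpa using h₅.2.2⟩
      have := GreedyIndep.card_prune_lt (C := Conf x bn bd) hvA
      omega
  · rintro s₃ - ⟨A, S, hI, hAc, -, hS, hSc⟩
    rw [hs₂.reg_m, Nat.sub_self, Nat.le_zero, Finset.card_eq_zero] at hAc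
    subst hAc
    refine ⟨S, hS, fun hk => ⟨hI.sel_sub.trans (Finset.filter_subset _ _), hSc ▸ hk, ?_⟩,
      hSc ▸ hcard S hI.sel_sub, ?_⟩
    · intro v hv w hw
      rcases eq_or_ne v w with rfl | hne
      exacts [(Finset.mem_filter.1 (hI.sel_sub hv)).2, hI.indep v hv w hw hne]
    · rintro ⟨T, hT⟩
      rw [hSc]
      refine hT.card.trans (hI.card_le (fun v hv => ?_) fun v hv w hw _ => hT.not_conf v hv w hw)
      exact Finset.mem_filter.2 ⟨hT.sub hv, hT.not_conf v hv v hv⟩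

end FairWord

/-! ### Reading and validating the input -/

namespace FairWord

open LogRAM

/-- Register `21` tells whether the input word is valid. -/
def validProg (D : ℕ) : Prog :=
  .seq (.assign 21 (.const 0))
    (.seq (.assign 4 (.add (.const 3) (.mul (.reg 1) (.reg 2))))
      (.seq (.assign 22 (.add (.reg 2) (.const D)))
        (.ite
          (.add
            (.add (.sub (.reg 0) (.add (.reg 4) (.mul (.const 2) (.reg 22))))
              (.sub (.add (.reg 4) (.mul (.const 2) (.reg 22))) (.reg 0)))
            (.add (.sub (.const 1) (.reg 3)) (.sub (.reg 3) (.reg 2))))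
          .skip
          (.seq (.assign 23 (.mul (.reg 1) (.reg 2)))
            (.seq (.assign 21 (.const 1))
              (.seq (checkLoop 7 23 .skip
                  (.sub (.get 0 (.add (.const 3) (.reg 7))) (.const 1)))
                (.seq (checkLoop 7 22 .skip (.sub (.const 1) (denE 7)))
                  (.seq (checkLoop 7 1 (sumLoop 8 2 (signE (adjE 7 8)))
                      (.sub (.reg 10) (.const 2)))
                    (checkLoop 8 2 (sumLoop 7 1 (signE (adjE 7 8)))
                      (.sub (.reg 10) (.const 2)))))))))))

/-- The parameters of the instance are loaded into registers, and the word is validated. -/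
def setupProg (D : ℕ) : Prog :=
  .seq (.assign 1 (.get 0 (.const 0)))
    (.seq (.assign 2 (.get 0 (.const 1)))
      (.seq (.assign 3 (.get 0 (.const 2))) (validProg D)))

variable {x : List ℕ} {N : ℕ} {s : State}

theorem mul_lt_two_pow {a b B : ℕ} (ha : a < 2 ^ B) (hb : b < 2 ^ B) : a * b < 2 ^ (2 * B) := by
  rw [two_mul, pow_add]
  exact Nat.mul_lt_mul'' ha hb

theorem fits_of_length {D : ℕ} (hN : 3 * inputSize x + 3 ≤ N)
    (hlen : x.length = 3 + nn x * mm x + 2 * (mm x + D)) (h1 : 1 ≤ kk x) (hk : kk x ≤ mm x) :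
    Fits x N := by
  have hl := length_le_inputSize x
  have hnm : nn x ≤ nn x * mm x := Nat.le_mul_of_pos_right _ (by omega)
  have hcell : ∀ i, cell x i < 2 ^ inputSize x := getD_lt_inputSize x
  have hlt : ∀ i j, cell x i * cell x j < 2 ^ (2 * inputSize x) := fun i j =>
    mul_lt_two_pow (hcell i) (hcell j)
  refine ⟨by omega, by omega, by omega, fun v w => ?_, fun v w => ?_⟩
  · have h2 : pnum x v w < 2 ^ (2 * inputSize x + 1) := by
      have := hlt (3 + nn x * mm x + 2 * v) (3 + nn x * mm x + 2 * w + 1)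
      have := hlt (3 + nn x * mm x + 2 * w) (3 + nn x * mm x + 2 * v + 1)
      rw [pow_succ]
      simp only [pnum, num, den]
      split_ifs <;> omega
    exact h2.trans_le (Nat.pow_le_pow_right two_pos (by omega))
  · exact (hlt _ _).trans_le (Nat.pow_le_pow_right two_pos (by omega))

/-- One side of the degree condition: `i` runs over the vertices of this side, `j` over those of the
other side. -/
theorem wp_degCheck {i b j c : ℕ} (f : ℕ → ℕ → ℕ) (hN : s.reg b ≤ N) (hN' : s.reg c ≤ N)
    (hd : [i, j, 10, 21, b].Nodup) (hc : c ∉ [i, j, 10, 21])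
    (hf : ∀ s', Frame [i, 21, j, 10] [] s s' → (adjE 7 8).eval s' = f (s'.reg i) (s'.reg j)) :
    WP N (checkLoop i b (sumLoop j c (signE (adjE 7 8))) (.sub (.reg 10) (.const 2)))
      (fun s' => s'.reg 21 ≠ 0 ↔ s.reg 21 ≠ 0 ∧ ∀ k < s.reg b,
        ((Finset.range (s.reg c)).filter fun l => f k l ≠ 0).card ≤ 2) s := by
  simp only [List.nodup_cons, List.mem_cons, List.not_mem_nil, not_or, or_false, not_false_eq_true,
    List.nodup_nil, and_true] at hd hc
  refine wp_checkLoop [j, 10] _ (by simp [sumLoop, Prog.forLoop, Prog.modReg])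
    (by simp [sumLoop, Prog.forLoop, Prog.modArr]) (by simp; omega) (by simp; omega) (by omega)
    (by omega) (by omega) (by simp; omega) hN fun k hk s₁ hF₁ hk₁ => ?_
  have hc₁ : s₁.reg c = s.reg c := hF₁.reg c (by simp; omega)
  refine wp_mono (wp_sumLoop (fun l => if f k l ≠ 0 then 1 else 0) (by omega) (by omega) (by omega)
    (by rw [hc₁]; exact hN') (fun l _ => by split_ifs <;> simp) fun l _ s₂ hF₂ hl => ?_)
    fun s₂ hsum => ?_
  · have h := hf s₂ (hF₁.trans (hF₂.mono (by simp +contextual) (by simp)))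
    rw [hl, hF₂.reg i (by simp; omega), hk₁] at h
    simp only [signE, Expr.eval, h]
    split_ifs <;> omega
  · rw [← Finset.card_filter, hc₁] at hsum
    simp only [Expr.eval, hsum, Nat.sub_eq_zero_iff_le]

theorem wp_validProg {D : ℕ} (hD : D ≤ 1) (hN : 3 * inputSize x + 3 ≤ N)
    (h0 : s.reg 0 = x.length) (ha : s.arr 0 = cell x) (hn : s.reg 1 = nn x) (hm : s.reg 2 = mm x)
    (hk : s.reg 3 = kk x) :
    WP N (validProg D) (fun s' => Base x s' ∧ (s'.reg 21 ≠ 0 ↔ Valid x D)) s := by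
  have hcell : ∀ i, cell x i < 2 ^ inputSize x := getD_lt_inputSize x
  have hnm : nn x * mm x < 2 ^ (2 * inputSize x) := mul_lt_two_pow (hcell 0) (hcell 1)
  have hpow : 4 * 2 ^ (2 * inputSize x) ≤ 2 ^ (N + 1) :=
    calc 4 * 2 ^ (2 * inputSize x) = 2 ^ (2 * inputSize x + 2) := by rw [pow_add]; ring
      _ ≤ _ := Nat.pow_le_pow_right two_pos (by omega)
  have hpos : 0 < 2 ^ (2 * inputSize x) := Nat.two_pow_pos _
  have hmm : mm x < 2 ^ (2 * inputSize x) :=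
    (hcell 1).trans_le (Nat.pow_le_pow_right two_pos (by omega))
  refine wp_seq (wp_assign (by simp [Expr.eval]) ?_)
  refine wp_seq (wp_assign (by simp [Expr.eval, hn, hm]; omega) ?_)
  refine wp_seq (wp_assign (by simp [Expr.eval, hm]; omega) ?_)
  simp only [Expr.eval, State.reg_setReg, hn, hm, if_false,
    show (1 : ℕ) ≠ 21 by decide, show (2 : ℕ) ≠ 21 by decide, show (2 : ℕ) ≠ 4 by decide]
  set s₁ := ((s.setReg 21 0).setReg 4 (3 + nn x * mm x)).setReg 22 (mm x + D) with hs₁def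
  have hs₁ : Base x s₁ := ⟨ha, by simp [hs₁def, hn], by simp [hs₁def, hm], by simp [hs₁def, hk],
    by simp [hs₁def]⟩
  have h22 : s₁.reg 22 = mm x + D := by simp [hs₁def]
  have h0₁ : s₁.reg 0 = x.length := by simp [hs₁def, h0]
  have h21 : s₁.reg 21 = 0 := by simp [hs₁def]
  refine wp_ite (fun h => wp_skip ⟨hs₁, ?_⟩) (fun h => ?_)
  · simp only [Expr.eval, h0₁, hs₁.reg_base, h22, hs₁.reg_k, hs₁.reg_m] at h
    simp only [h21, ne_eq, not_true_eq_false, false_iff]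
    intro hV
    have := hV.len
    have := hV.one_le_k
    have := hV.k_le_m
    omega
  simp only [Expr.eval, h0₁, hs₁.reg_base, h22, hs₁.reg_k, hs₁.reg_m] at h
  have hlen : x.length = 3 + nn x * mm x + 2 * (mm x + D) := by omega
  have h1 : 1 ≤ kk x := by omega
  have hkm : kk x ≤ mm x := by omega
  have hF := fits_of_length hN hlen h1 hkm
  have hnN := hF.n_le
  have hmN := hF.m_lt
  have hnmN := hF.nm_le
  refine wp_seq (wp_assign (by simp [Expr.eval, hs₁.reg_n, hs₁.reg_m]; omega) ?_)
  refine wp_seq (wp_assign (by simp [Expr.eval]) ?_)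
  simp only [Expr.eval, hs₁.reg_n, hs₁.reg_m]
  set s₂ := (s₁.setReg 23 (nn x * mm x)).setReg 21 1 with hs₂def
  have hF₂ : Frame [23, 21] [] s₁ s₂ :=
    (Frame.setReg _ (by simp) _).trans (Frame.setReg _ (by simp) _)
  have hs₂ := hs₁.frame hF₂ (by decide) (by decide)
  have h23 : s₂.reg 23 = nn x * mm x := by simp [hs₂def]
  have h21₂ : s₂.reg 21 = 1 := by simp [hs₂def]
  refine wp_seq (wp_frame [7, 21] [] (by decide) (by decide) (wp_mono
    (wp_checkLoop [] (fun i => cell x (3 + i) ≤ 1) (by decide) (by decide) (by decide) (by decide)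
      (by decide) (by decide) (by decide) (by decide) (by omega) fun k _ s' hF' hk' =>
        wp_skip ?_) fun s₃ h₃ hF₃ => ?_))
  · have hs' := hs₂.frame hF' (by decide) (by decide)
    simp only [Expr.eval, hk', hs'.arr_zero, Nat.sub_eq_zero_iff_le]
  have hs₃ := hs₂.frame hF₃ (by decide) (by decide)
  have h22₃ : s₃.reg 22 = mm x + D := by
    rw [hF₃.reg 22 (by decide), hF₂.reg 22 (by decide), h22]
  refine wp_seq (wp_frame [7, 21] [] (by decide) (by decide) (wp_mono
    (wp_checkLoop [] (fun v => den x v ≠ 0) (by decide) (by decide) (by decide) (by decide)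
      (by decide) (by decide) (by decide) (by decide) (by omega) fun k _ s' hF' hk' =>
        wp_skip ?_) fun s₄ h₄ hF₄ => ?_))
  · have hs' := hs₃.frame hF' (by decide) (by decide)
    simp only [Expr.eval, hs'.eval_denE, hk']
    omega
  have hs₄ := hs₃.frame hF₄ (by decide) (by decide)
  refine wp_seq (wp_frame [7, 21, 8, 10] [] (by decide) (by decide) (wp_mono
    (wp_degCheck (adj x) (by rw [hs₄.reg_n]; omega) (by rw [hs₄.reg_m]; omega) (by decide)
      (by decide) fun s' hF' => (hs₄.frame hF' (by decide) (by decide)).eval_adjE 7 8)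
    fun s₅ h₅ hF₅ => ?_))
  have hs₅ := hs₄.frame hF₅ (by decide) (by decide)
  refine wp_frame [8, 21, 7, 10] [] (by decide) (by decide) (wp_mono
    (wp_degCheck (fun v u => adj x u v) (by rw [hs₅.reg_m]; omega) (by rw [hs₅.reg_n]; omega)
      (by decide) (by decide)
      fun s' hF' => (hs₅.frame hF' (by decide) (by decide)).eval_adjE 7 8)
    fun s₆ h₆ hF₆ => ?_)
  refine ⟨hs₅.frame hF₆ (by decide) (by decide), ?_⟩
  rw [h₆, h₅, h₄, h₃, h21₂, h23, h22₃, hs₄.reg_n, hs₄.reg_m, hs₅.reg_n, hs₅.reg_m]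
  exact ⟨fun ⟨⟨⟨⟨_, a⟩, b⟩, c⟩, d⟩ => ⟨hlen, h1, hkm, a, b, c, d⟩,
    fun hV => ⟨⟨⟨⟨one_ne_zero, hV.adj_le⟩, hV.den_ne⟩, hV.deg_left⟩, hV.deg_right⟩⟩

theorem wp_setupProg {D : ℕ} (hD : D ≤ 1) (hN : 3 * inputSize x + 3 ≤ N) :
    WP N (setupProg D) (fun s' => Base x s' ∧ (s'.reg 21 ≠ 0 ↔ Valid x D)) (State.init x) := by
  have hcell : ∀ i, cell x i < 2 ^ (N + 1) := fun i =>
    (getD_lt_inputSize x i).trans_le (Nat.pow_le_pow_right two_pos (by omega))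
  refine wp_seq (wp_assign (by simpa [Expr.eval, State.init, cell] using hcell 0) ?_)
  refine wp_seq (wp_assign (by simpa [Expr.eval, State.init, cell] using hcell 1) ?_)
  refine wp_seq (wp_assign (by simpa [Expr.eval, State.init, cell] using hcell 2) ?_)
  refine wp_validProg hD hN ?_ ?_ ?_ ?_ ?_
  all_goals simp [Expr.eval, State.init, nn, mm, kk, cell]
  all_goals rfl

theorem Valid.fits {D : ℕ} (h : Valid x D) (hN : 3 * inputSize x + 3 ≤ N) : Fits x N :=
  fits_of_length hN h.len h.one_le_k h.k_le_m

/-! ### The decision problem -/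

/-- The program for the decision problem. -/
def decisionProg : Prog :=
  .seq (setupProg 1)
    (.ite (.reg 21)
      (.seq (.assign 5 (numE 2)) (.seq (.assign 6 (denE 2))
        (.seq solveProg (.assign 0 (.sub (.add (.reg 11) (.const 1)) (.reg 3))))))
      (.assign 0 (.const 0)))

theorem wp_decisionProg (hN : 3 * inputSize x + 3 ≤ N) :
    WP N decisionProg (fun s => s.reg 0 ≠ 0 ↔
      Valid x 1 ∧ ∃ T, IsSol x (num x (mm x)) (den x (mm x)) T) (State.init x) := by
  have hcell : ∀ i, cell x i < 2 ^ (N + 1) := fun i =>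
    (getD_lt_inputSize x i).trans_le (Nat.pow_le_pow_right two_pos (by omega))
  refine wp_seq (wp_mono (wp_setupProg le_rfl hN) fun s hs => ?_)
  obtain ⟨hs, hV⟩ := hs
  refine wp_ite (fun h => ?_) fun h => ?_
  · replace hV := hV.1 h
    have hF := hV.fits hN
    have hmN := hF.m_lt
    refine wp_seq (wp_assign (by rw [hs.eval_numE]; exact hcell _) ?_)
    rw [hs.eval_numE, hs.reg_m]
    have hs₁ := hs.frame (Frame.setReg (R := [5]) (A := []) (r := 5) s (by simp) (num x (mm x)))
      (by decide) (by decide)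
    refine wp_seq (wp_assign (by rw [hs₁.eval_denE]; exact hcell _) ?_)
    rw [hs₁.eval_denE, hs₁.reg_m]
    have hs₂ := hs₁.frame (Frame.setReg (R := [6]) (A := []) (r := 6) _ (by simp) (den x (mm x)))
      (by decide) (by decide)
    refine wp_seq (wp_frame [7, 8, 9, 10, 11, 12, 13, 14, 15] [2, 3, 4] (by decide) (by decide)
      (wp_mono (wp_solveProg hV hF hs₂) fun s₃ h₃ hF₃ => ?_))
    have hs₃ := hs₂.frame hF₃ (by decide) (by decide)
    obtain ⟨S, -, hS, hle, hT⟩ := h₃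
    simp only [State.reg_setReg, if_true, show (5 : ℕ) ≠ 6 by decide, if_false] at hS hT
    refine wp_assign (lt_two_pow_succ (by simp only [Expr.eval]; omega)) ?_
    simp only [Expr.eval, State.reg_setReg, if_true, hs₃.reg_k]
    constructor
    · exact fun h => ⟨hV, S, hS (by omega)⟩
    · rintro ⟨-, h⟩
      have := hT h
      omega
  · refine wp_assign (by simp [Expr.eval]) ?_
    have : ¬ Valid x 1 := fun h' => hV.2 h' h
    simp [Expr.eval, this]

theorem mem_decisionProblem_iff : x ∈ FairSetSelection.decisionProblem 2 ↔
    Valid x 1 ∧ ∃ T, IsSol x (num x (mm x)) (den x (mm x)) T := by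
  constructor
  · rintro ⟨I, y, bn, bd, hd, hy, hbd, rfl, S, hS⟩
    obtain ⟨hrep, hlen, htail⟩ := represents_of_isEncoding hy [bn, bd]
    have hnum : num (y ++ [bn, bd]) I.m = bn := by
      rw [num, hrep.n_eq, hrep.m_eq]
      exact htail 0
    have hden : den (y ++ [bn, bd]) I.m = bd := by
      rw [den, hrep.n_eq, hrep.m_eq]
      exact htail 1
    refine ⟨hrep.valid hd (by rw [hlen]; simp; ring) fun v hv hv' => ?_,
      S.map Fin.valEmbedding, ?_⟩
    · obtain rfl : v = I.m := by omega
      rwa [hden]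
    · rw [hrep.m_eq, hnum, hden]
      exact (hrep.isSol_map_iff hd hbd S).2 hS
  · rintro ⟨hV, T, hT⟩
    obtain ⟨I, y, hrep, hd, hy, hx⟩ := exists_instance hV
    have hbd : den x (mm x) ≠ 0 := hV.den_ne _ (Nat.lt_succ_self _)
    obtain ⟨S, rfl, -⟩ := hrep.exists_map_eq hT
    exact ⟨I, y, _, _, hd, hy, hbd, hx, S, (hrep.isSol_map_iff hd hbd S).1 hT⟩

/-! ### The optimization problem -/

/-- The numerators of the candidate thresholds: the weights of pairs, and `0` for `i = mm x`. -/
def thrNum (x : List ℕ) (i j : ℕ) : ℕ := if i < mm x then pnum x i j else 0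

/-- The denominators of the candidate thresholds. -/
def thrDen (x : List ℕ) (i j : ℕ) : ℕ := if i < mm x then pden x i j else 1

/-- The candidate threshold with the indices in the registers `16` and `17`. -/
def thrProg : Prog :=
  .ite (.sub (.reg 2) (.reg 16))
    (.seq (.assign 5 (pnumE 16 17)) (.assign 6 (pdenE 16 17)))
    (.seq (.assign 5 (.const 0)) (.assign 6 (.const 1)))

/-- The selection in array `2` and its threshold become the best solution so far, which stands in
array `1` and the registers `19` and `20`. -/
def copyProg : Prog :=
  .seq (.assign 18 (.const 1))
    (.seq (.assign 19 (.reg 5))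
      (.seq (.assign 20 (.reg 6)) (.forLoop 7 2 (.store 1 (.reg 7) (.get 2 (.reg 7))))))

/-- One candidate threshold is tried, unless it is no improvement. -/
def tryProg : Prog :=
  .seq thrProg
    (.ite (.add (.sub (.const 1) (.reg 18))
        (.sub (.mul (.reg 19) (.reg 6)) (.mul (.reg 5) (.reg 20))))
      (.seq solveProg (.ite (.sub (.add (.reg 11) (.const 1)) (.reg 3)) copyProg .skip))
      .skip)

/-- The program for the optimization problem. -/
def optimumProg : Prog :=
  .seq (setupProg 0)
    (.ite (.reg 21)
      (.seq (.assign 22 (.add (.reg 2) (.const 1)))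
        (.seq (.assign 18 (.const 0))
          (.seq (.forLoop 16 22 (.forLoop 17 2 tryProg)) (.assign 0 (.reg 2)))))
      .skip)

/-- The memory holds a solution for the least among those candidate thresholds with an index in `P`
for which there is a solution; register `18` is `0` if there are none. -/
def Best (x : List ℕ) (P : ℕ → ℕ → Prop) (s : State) : Prop :=
  (s.reg 18 = 0 ∧ ∀ i j, P i j → ¬ ∃ T, IsSol x (thrNum x i j) (thrDen x i j) T) ∨
    (s.reg 18 ≠ 0 ∧ s.reg 20 ≠ 0 ∧ ∃ T, IsSol x (s.reg 19) (s.reg 20) T ∧ Marks (mm x) 1 T s ∧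
      ∀ i j, P i j → (∃ T', IsSol x (thrNum x i j) (thrDen x i j) T') →
        (s.reg 19 : ℚ≥0) / (s.reg 20 : ℚ≥0) ≤ (thrNum x i j : ℚ≥0) / (thrDen x i j : ℚ≥0))

theorem Best.mono {P P' : ℕ → ℕ → Prop} (h : Best x P s) (hP : ∀ i j, P' i j → P i j) :
    Best x P' s := by
  rcases h with ⟨h, h'⟩ | ⟨h1, h2, T, h3, h4, h5⟩
  · exact .inl ⟨h, fun i j hij => h' i j (hP i j hij)⟩
  · exact .inr ⟨h1, h2, T, h3, h4, fun i j hij => h5 i j (hP i j hij)⟩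

theorem Best.congr {P : ℕ → ℕ → Prop} {s' : State} (h : Best x P s) (h18 : s'.reg 18 = s.reg 18)
    (h19 : s'.reg 19 = s.reg 19) (h20 : s'.reg 20 = s.reg 20) (h1 : s'.arr 1 = s.arr 1) :
    Best x P s' := by
  simp only [Best, Marks, h18, h19, h20, h1] at h ⊢
  exact h

theorem wp_thrProg (hN : Fits x N) (hs : Base x s) :
    WP N thrProg (fun s' => s'.reg 5 = thrNum x (s.reg 16) (s.reg 17) ∧
      s'.reg 6 = thrDen x (s.reg 16) (s.reg 17)) s := by
  refine wp_ite (fun h => ?_) fun h => ?_ <;> simp only [Expr.eval, hs.reg_m] at h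
  · rw [thrNum, thrDen, if_pos (by omega), if_pos (by omega)]
    refine wp_seq (wp_assign (by rw [hs.eval_pnumE]; exact hN.pnum_lt _ _) ?_)
    have hs₁ := hs.frame (Frame.setReg (R := [5]) (A := []) (r := 5) s (by simp)
      ((pnumE 16 17).eval s)) (by decide) (by decide)
    refine wp_assign (by rw [hs₁.eval_pdenE]; exact hN.pden_lt _ _) ?_
    rw [hs₁.eval_pdenE, hs.eval_pnumE]
    simp
  · rw [thrNum, thrDen, if_neg (by omega), if_neg (by omega)]
    exact wp_seq (wp_assign (by simp [Expr.eval]) (wp_assign (by simp [Expr.eval]) (by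
      simp [Expr.eval])))

theorem wp_copyProg (hN : Fits x N) (hs : Base x s) {T : Finset ℕ} (hT : Marks (mm x) 2 T s) :
    WP N copyProg (fun s' => s'.reg 18 = 1 ∧ s'.reg 19 = s.reg 5 ∧ s'.reg 20 = s.reg 6 ∧
      Marks (mm x) 1 T s') s := by
  have hmN := hN.m_lt
  refine wp_bounded fun hb => ?_
  refine wp_seq (wp_assign (by simp [Expr.eval]) ?_)
  refine wp_seq (wp_assign (by simpa [Expr.eval] using hb.1 5) ?_)
  refine wp_seq (wp_assign (by simpa [Expr.eval] using hb.1 6) ?_)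
  simp only [Expr.eval, State.reg_setReg, show (5 : ℕ) ≠ 18 by decide, show (6 : ℕ) ≠ 18 by decide,
    show (6 : ℕ) ≠ 19 by decide, if_false]
  set s₀ := ((s.setReg 18 1).setReg 19 (s.reg 5)).setReg 20 (s.reg 6) with hs₀
  have h2 : s₀.reg 2 = mm x := by simp [hs₀, hs.reg_m]
  refine wp_for [] [1] (fun k s' => Marks k 1 T s') (by decide) (by decide) (by decide) (by decide)
    (by decide) (by omega) (by simp [Marks]) ?_ ?_
  · intro k hk s₁ hF₁ hk₁ hI
    rw [h2] at hk
    have hev : (Expr.get 2 (.reg 7)).eval s₁ = if k ∈ T then 1 else 0 := by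
      simp only [Expr.eval, hk₁, hF₁.arr 2 (by decide)]
      exact hT k hk
    refine wp_store ?_ fun _ _ v hv => ?_
    · rw [hev]
      split_ifs <;> simp
    · rw [hev]
      rcases eq_or_ne v k with rfl | hne
      · simp [Expr.eval, hk₁]
      · simp [Expr.eval, hk₁, hne, hI v (by omega)]
  · rw [h2]
    intro s₁ hF₁ hI
    refine ⟨?_, ?_, ?_, hI⟩
    · rw [hF₁.reg 18 (by decide)]; simp [hs₀]
    · rw [hF₁.reg 19 (by decide)]; simp [hs₀]
    · rw [hF₁.reg 20 (by decide)]; simp [hs₀]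

theorem Valid.thrDen_ne {D : ℕ} (hV : Valid x D) {i j : ℕ} (hj : j < mm x) : thrDen x i j ≠ 0 := by
  rw [thrDen]
  split_ifs with hi
  · exact mul_ne_zero (hV.den_ne i (by omega)) (hV.den_ne j (by omega))
  · exact one_ne_zero

theorem wp_tryProg {D : ℕ} (hV : Valid x D) (hN : Fits x N) (hs : Base x s) {i j : ℕ}
    (hi : s.reg 16 = i) (hj : s.reg 17 = j) (hjm : j < mm x) {P : ℕ → ℕ → Prop}
    (hB : Best x P s) :
    WP N tryProg (Best x fun a b => P a b ∨ (a = i ∧ b = j)) s := by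
  have hmN := hN.m_lt
  have htd : thrDen x i j ≠ 0 := hV.thrDen_ne hjm
  have htd' : (0 : ℚ≥0) < thrDen x i j := Nat.cast_pos.2 (Nat.pos_of_ne_zero htd)
  refine wp_seq (wp_frame [5, 6] [] (by decide) (by decide)
    (wp_mono (wp_thrProg hN hs) fun s₁ h₁ hF₁ => ?_))
  rw [hi, hj] at h₁
  obtain ⟨h5, h6⟩ := h₁
  have hs₁ := hs.frame hF₁ (by decide) (by decide)
  have hB₁ : Best x P s₁ := hB.congr (hF₁.reg 18 (by decide)) (hF₁.reg 19 (by decide))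
    (hF₁.reg 20 (by decide)) (hF₁.arr 1 (by decide))
  refine wp_ite (fun h => ?_) fun h => wp_skip ?_
  · refine wp_seq (wp_frame [7, 8, 9, 10, 11, 12, 13, 14, 15] [2, 3, 4] (by decide) (by decide)
      (wp_mono (wp_solveProg hV hN hs₁) fun s₂ h₂ hF₂ => ?_))
    have hs₂ := hs₁.frame hF₂ (by decide) (by decide)
    have hB₂ : Best x P s₂ := hB₁.congr (hF₂.reg 18 (by decide)) (hF₂.reg 19 (by decide))
      (hF₂.reg 20 (by decide)) (hF₂.arr 1 (by decide))
    rw [h5, h6] at h₂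
    obtain ⟨S, hS, hS', -, hT⟩ := h₂
    refine wp_ite (fun hc => ?_) fun hc => wp_skip ?_ <;>
      simp only [Expr.eval, hs₂.reg_k] at hc
    · refine wp_mono (wp_copyProg hN hs₂ hS) fun s₃ h₃ => ?_
      rw [hF₂.reg 5 (by decide), hF₂.reg 6 (by decide), h5, h6] at h₃
      obtain ⟨h18, h19, h20, hM⟩ := h₃
      refine .inr ⟨by rw [h18]; exact one_ne_zero, by rwa [h20], S, ?_, hM, ?_⟩
      · rw [h19, h20]
        exact hS' (by omega)
      · rw [h19, h20]
        rintro a b (hab | ⟨rfl, rfl⟩) hsol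
        · rcases hB₁ with ⟨-, hB₁⟩ | ⟨hB18, hB20, -, -, -, hB₁⟩
          · exact absurd hsol (hB₁ a b hab)
          · -- The threshold has been tried because it is less than the best one so far.
            refine le_trans ?_ (hB₁ a b hab hsol)
            simp only [Expr.eval, h5, h6] at h
            have hlt : thrNum x i j * s₁.reg 20 ≤ s₁.reg 19 * thrDen x i j := by omega
            rw [div_le_div_iff₀ htd' (Nat.cast_pos.2 (Nat.pos_of_ne_zero hB20))]
            exact_mod_cast hlt
        · exact le_rfl
    · have hno : ¬ ∃ T, IsSol x (thrNum x i j) (thrDen x i j) T := fun h => by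
        have := hT h
        omega
      rcases hB₂ with ⟨hB18, hB₂⟩ | ⟨hB18, hB20, T, hB1, hB2, hB₂⟩
      · refine .inl ⟨hB18, ?_⟩
        rintro a b (hab | ⟨rfl, rfl⟩)
        exacts [hB₂ a b hab, hno]
      · refine .inr ⟨hB18, hB20, T, hB1, hB2, ?_⟩
        rintro a b (hab | ⟨rfl, rfl⟩) hsol
        exacts [hB₂ a b hab hsol, absurd hsol hno]
  · simp only [Expr.eval, h5, h6] at h
    rcases hB₁ with ⟨hB18, -⟩ | ⟨hB18, hB20, T, hB1, hB2, hB₁⟩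
    · omega
    · refine .inr ⟨hB18, hB20, T, hB1, hB2, ?_⟩
      rintro a b (hab | ⟨rfl, rfl⟩) hsol
      · exact hB₁ a b hab hsol
      · have hle : s₁.reg 19 * thrDen x a b ≤ thrNum x a b * s₁.reg 20 := by omega
        rw [div_le_div_iff₀ (Nat.cast_pos.2 (Nat.pos_of_ne_zero hB20)) htd']
        exact_mod_cast hle

theorem wp_optimumProg (hN : 3 * inputSize x + 3 ≤ N) :
    WP N optimumProg (fun s => Valid x 0 → s.reg 0 = mm x ∧
      Best x (fun i j => i ≤ mm x ∧ j < mm x) s) (State.init x) := by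
  refine wp_seq (wp_mono (wp_setupProg (by simp) hN) fun s hs => ?_)
  obtain ⟨hs, hV⟩ := hs
  refine wp_ite (fun h => ?_) fun h => wp_skip fun hV' => absurd h (hV.2 hV')
  replace hV := hV.1 h
  have hF := hV.fits hN
  have hmN := hF.m_lt
  refine wp_seq (wp_assign (lt_two_pow_succ (by simp only [Expr.eval, hs.reg_m]; omega)) ?_)
  refine wp_seq (wp_assign (by simp [Expr.eval]) ?_)
  simp only [Expr.eval, hs.reg_m]
  set s₀ := (s.setReg 22 (mm x + 1)).setReg 18 0 with hs₀def
  have hs₀ := hs.frame (show Frame [22, 18] [] s s₀ from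
    (Frame.setReg _ (by simp) _).trans (Frame.setReg _ (by simp) _)) (by decide) (by decide)
  have h22 : s₀.reg 22 = mm x + 1 := by simp [hs₀def]
  refine wp_seq (wp_for [17, 5, 6, 7, 8, 9, 10, 11, 12, 13, 14, 15, 18, 19, 20] [1, 2, 3, 4]
    (fun k s' => Best x (fun a b => a < k ∧ b < mm x) s') (by decide) (by decide) (by decide)
    (by decide) (by decide) (by omega) (.inl ⟨by simp [hs₀def], by simp⟩) ?_ ?_)
  · intro k hk s₁ hF₁ hk₁ hI
    have hs₁ := hs₀.frame hF₁ (by decide) (by decide)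
    refine wp_for [5, 6, 7, 8, 9, 10, 11, 12, 13, 14, 15, 18, 19, 20] [1, 2, 3, 4]
      (fun l s' => Best x (fun a b => b < mm x ∧ (a < k ∨ a = k ∧ b < l)) s')
      (by decide) (by decide) (by decide) (by decide) (by decide) (by rw [hs₁.reg_m]; omega) ?_ ?_
      ?_
    · exact (hI.mono (by omega)).congr (by simp) (by simp) (by simp) (by simp)
    · intro l hl s₂ hF₂ hl₂ hI₂
      have hs₂ := hs₁.frame hF₂ (by decide) (by decide)
      rw [hs₁.reg_m] at hl
      refine wp_mono (wp_tryProg hV hF hs₂ ((hF₂.reg 16 (by decide)).trans hk₁) hl₂ hl hI₂)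
        fun s₃ h₃ _ _ => ?_
      exact (h₃.mono (by omega)).congr (by simp) (by simp) (by simp) (by simp)
    · rw [hs₁.reg_m]
      intro s₂ _ hI₂ _ _
      exact (hI₂.mono (by omega)).congr (by simp) (by simp) (by simp) (by simp)
  · rw [h22]
    intro s₁ hF₁ hI
    have hs₁ := hs₀.frame hF₁ (by decide) (by decide)
    refine wp_assign (lt_two_pow_succ (by simp only [Expr.eval, hs₁.reg_m]; omega)) fun _ => ?_
    refine ⟨by simp [Expr.eval, hs₁.reg_m], ?_⟩
    exact (hI.mono (by omega)).congr (by simp) (by simp) (by simp) (by simp)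

/-- The minimum maximum disagreement is one of the candidate thresholds, and so the best solution
for a candidate threshold is optimal. -/
theorem exists_isOptimal {I : FairSetSelection} (h : Represents x I) (hd : I.maxDegree ≤ 2)
    (hV : Valid x 0) {S₀ : Finset (Fin I.m)} (hS₀ : I.IsOptimal S₀) (h0 : s.reg 0 = mm x)
    (hB : Best x (fun i j => i ≤ mm x ∧ j < mm x) s) :
    ∃ S, I.IsOptimal S ∧ s.output = I.selectionWord S := by
  have hm : 0 < mm x := lt_of_lt_of_le hV.one_le_k hV.k_le_m
  obtain ⟨i, j, hi, hj, hthr⟩ : ∃ i j, i ≤ mm x ∧ j < mm x ∧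
      I.maxDis S₀ = (thrNum x i j : ℚ≥0) / (thrDen x i j : ℚ≥0) := by
    rcases h.maxDis_eq hd S₀ with h0 | ⟨v, w, hvw⟩
    · exact ⟨mm x, 0, le_rfl, hm, by simp [h0, thrNum]⟩
    · have hv : (v : ℕ) < mm x := v.2.trans_eq h.m_eq.symm
      exact ⟨v, w, hv.le, w.2.trans_eq h.m_eq.symm, by
        rw [hvw, thrNum, thrDen, if_pos hv, if_pos hv]⟩
  have hsol : ∃ T, IsSol x (thrNum x i j) (thrDen x i j) T :=
    ⟨_, (h.isSol_map_iff hd (hV.thrDen_ne hj) S₀).2 ⟨hS₀.1, hthr.le⟩⟩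
  rcases hB with ⟨-, hB⟩ | ⟨-, hB20, T, hT, hM, hB⟩
  · exact absurd hsol (hB i j ⟨hi, hj⟩)
  · obtain ⟨S, rfl, hmem⟩ := h.exists_map_eq hT
    obtain ⟨hfeas, hdis⟩ := (h.isSol_map_iff hd hB20 S).1 hT
    refine ⟨S, ⟨hfeas, fun S' hS' => ?_⟩, ?_⟩
    · exact (hdis.trans (hB i j ⟨hi, hj⟩ hsol)).trans (hthr.symm.le.trans (hS₀.2 S' hS'))
    · rw [State.output, h0, FairSetSelection.selectionWord]
      refine List.ext_getElem (by simp [h.m_eq]) fun v hv hv' => ?_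
      rw [List.length_ofFn] at hv'
      rw [List.getElem_map, List.getElem_range, List.getElem_ofFn, hM v (hv'.trans_eq h.m_eq.symm)]
      exact if_congr (hmem ⟨v, hv'⟩).symm rfl rfl

end FairWord

theorem mainTheorem6 :
    LogRAM.InP (FairSetSelection.decisionProblem 2) ∧
      LogRAM.PolyTimeSolvable (FairSetSelection.optimizationProblem 2) := by
  have heval : ∀ (p : Polynomial ℕ) (x : List ℕ),
      (p.comp (3 * Polynomial.X + 3)).eval (LogRAM.inputSize x) =
        p.eval (3 * LogRAM.inputSize x + 3) := fun p x => by
    rw [Polynomial.eval_comp]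
    simp
  constructor
  · refine ⟨FairWord.decisionProg, FairWord.decisionProg.timePoly.comp (3 * .X + 3), fun x => ?_⟩
    obtain ⟨t, s, he, ht, -, hs⟩ :=
      FairWord.wp_decisionProg (x := x) le_rfl (LogRAM.bounded_init x (by omega))
    exact ⟨t, s, he, by rwa [heval], by rw [hs, FairWord.mem_decisionProblem_iff]⟩
  · refine ⟨FairWord.optimumProg, FairWord.optimumProg.timePoly.comp (3 * .X + 3), fun x => ?_⟩
    obtain ⟨t, s, he, ht, -, hs⟩ :=
      FairWord.wp_optimumProg (x := x) le_rfl (LogRAM.bounded_init x (by omega))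
    refine ⟨t, s, he, by rwa [heval], ?_⟩
    rintro ⟨y, I, hd, hI, S, hS, -⟩
    obtain ⟨hrep, hlen, -⟩ := FairWord.represents_of_isEncoding hI []
    rw [List.append_nil] at hrep hlen
    have hV : FairWord.Valid x 0 :=
      hrep.valid hd (by rw [hlen]; simp) fun v hv hv' => by omega
    obtain ⟨S', hS', hout⟩ :=
      FairWord.exists_isOptimal hrep hd hV hS (hs hV).1 (hs hV).2
    exact ⟨I, hd, hI, S', hS', hout⟩
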